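/- Setting. Let $\mathsf N\ge 0$ sites carry spins $s_1,\dots,s_{\mathsf N}$ with $2s_n\in\mathbb Z_{>0}$, let $\eta\in\mathbb C\setminus\{0\}$, and let $\mathcal H=\bigotimes_{n=1}^{\mathsf N}\mathbb C^{2s_n+1}$. Let $S_n^z=\mathrm{diag}(s_n,s_n-1,\dots,-s_n)$, let $S_n^+$ have the entries $\sqrt{j(2s_n+1-j)}$ at the positions $(j,j+1)$ and $0$ elsewhere, and let $S_n^-=(S_n^+)^t$. For inhomogeneities $\xi_1,\dots,\xi_{\mathsf N}\in\mathbb C$ and a twist matrix $K=\begin{pmatrix}a&b\\c&d\end{pmatrix}\in\mathrm{End}(\mathbb C^2)$ put $$\mathsf L_{0n}(\lambda)=\begin{pmatrix}\lambda+\eta(\tfrac12+S_n^z)&\eta S_n^-\\ \eta S_n^+&\lambda+\eta(\tfrac12-S_n^z)\end{pmatrix}_{0},\qquad \mathsf M_0^{(K)}(\lambda)=K_0\,\mathsf L_{0\mathsf N}(\lambda-\xi_{\mathsf N})\cdots\mathsf L_{01}(\lambda-\xi_1)=\begin{pmatrix}\mathsf A^{(K)}(\lambda)&\mathsf B^{(K)}(\lambda)\\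 \mathsf C^{(K)}(\lambda)&\mathsf D^{(K)}(\lambda)\end{pmatrix}_0 .$$ For $m\ge 0$ let $P^+$ be the symmetrizer of $(\mathbb C^2)^{\otimes m}$, let $V_m^+$ be its image, and let $$\mathsf T^{(K|m)}(\lambda)=\mathrm{tr}_{V_m^+}\,P^+\,\mathsf M_1^{(K)}(\lambda+(m-1)\eta)\cdots\mathsf M_m^{(K)}(\lambda)\,P^+\in\mathrm{End}(\mathcal H),\qquad \mathsf T^{(K|0)}=1 .$$ Put $\xi_n^{(k)}=\xi_n-\frac\eta2+(s_n-k)\eta$ and $$a(\lambda)=\prod_{n=1}^{\mathsf N}\big(\lambda-\xi_n+\tfrac\eta2+s_n\eta\big),\qquad d(\lambda)=\prod_{n=1}^{\mathsf N}\big(\lambda-\xi_n+\tfrac\eta2-s_n\eta\big).$$ Let $\langle 0|=\bigotimes_n(1,0,\dots,0)$. Let $\mathsf k_1,\mathsf k_2$ be the eigenvalues of $K$, with multiplicity and in either order. Put $\textsc n=\prod_{1\le q<p\le\mathsf N}(\xi_p^{(0)}-\xi_q^{(0)})^{1/2}$, and for $\mathbf h=(h_1,\dots,h_{\mathsf N})$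 with $0\le h_n\le 2s_n$ put $$\langle\mathbf h|_{Sk}^{(K)}=\frac1{\textsc n}\langle0|\prod_{n=1}^{\mathsf N}\prod_{k=0}^{h_n-1}\frac{\mathsf A^{(K)}(\xi_n^{(k)})}{\mathsf k_1a(\xi_n^{(k)})}.$$ For an invertible $W\in\mathrm{End}(\mathbb C^2)$ let $\bar K=W^{-1}KW=\begin{pmatrix}\bar a&\bar b\\ \bar c&\bar d\end{pmatrix}$, let $W^{(m)}$ be the restriction of $W^{\otimes m}$ to $V_m^+\simeq\mathbb C^{m+1}$ (written in the orthonormal basis of normalized symmetric vectors), let $\mathcal W=\bigotimes_nW^{(2s_n)}$, and put $$\underline{\langle\mathbf h|}_{Sk}=\langle\mathbf h|_{Sk}^{(\bar K)}\,\mathcal W^{-1},\qquad \tilde{\mathsf B}^{(K)}(\lambda)=\mathrm{tr}_0\Big[W_0\begin{pmatrix}0&0\\1&0\end{pmatrix}_0W_0^{-1}\mathsf M_0^{(K)}(\lambda)\Big].$$ Theorem. Let $K$ be invertible and not proportional to the identity. Let the inhomogeneities be such that the strings $\{\xi_n^{(0)},\dots,\xi_n^{(2s_n)}\}$ of different sites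 are disjoint (this excludes only finitely many hyperplanes; when the spins differ by integers it follows from $\xi_n\ne\xi_m \bmod \eta$ for $n\neq m$). For a covector $\langle S|$ put $$\langle\mathbf h|=\langle S|\prod_{n=1}^{\mathsf N}\frac{\mathsf k_2^{\,h_n-2s_n}\,\mathsf T^{(K|2s_n-h_n)}(\xi_n^{(2s_n)})}{\prod_{k=0}^{2s_n-h_n-1}d(\xi_n^{(2s_n-k)})},\qquad 0\le h_n\le 2s_n .$$ Then there is a nonzero polynomial in the components of $\langle S|$ such that, for every $\langle S|$ at which it does not vanish, the covectors $\langle\mathbf h|$ form a basis of the space of covectors of $\mathcal H$. Moreover: (a) If $b\ne0$, the covectors $\langle\mathbf h|_{Sk}^{(K)}$ form a basis, $\langle\mathbf h|_{Sk}^{(K)}\,\mathsf B^{(K)}(\lambda)=b\prod_n(\lambda-\xi_n^{(h_n)})\,\langle\mathbf h|_{Sk}^{(K)}$ for all $\lambda$, and for $\langle S|=\langle 2s_1,\dots,2s_{\mathsf N}|_{Sk}^{(K)}$ one has $\langle\mathbf h|=\langle\mathbf h|_{Sk}^{(K)}$ for all $\mathbf h$. (b) If $b=0$, there is an invertible $W$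 with $\bar b\ne0$ and $\bar c\ne0$; and for every invertible $W$ with $\bar b\neq0$ the covectors $\underline{\langle\mathbf h|}_{Sk}$ form a basis, $\underline{\langle\mathbf h|}_{Sk}\,\tilde{\mathsf B}^{(K)}(\lambda)=\bar b\prod_n(\lambda-\xi_n^{(h_n)})\,\underline{\langle\mathbf h|}_{Sk}$ for all $\lambda$, and for $\langle S|=\underline{\langle2s_1,\dots,2s_{\mathsf N}|}_{Sk}$ one has $\langle\mathbf h|=\underline{\langle\mathbf h|}_{Sk}$ for all $\mathbf h$. -/

import Mathlib

/-- Operators on a tensor product `⨂ n, V n`, written in the product basis. The basis of `V n` is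
indexed by `κ n`, and `embedAt n X` is the operator acting as `X` on the `n`-th factor and as the
identity on all the others. The entries live in a ring `R`, so that the same definition serves for
auxiliary spaces, where `R` is the algebra of operators on the quantum space. -/
def embedAt {ι : Type} [Fintype ι] [DecidableEq ι] {κ : ι → Type} [∀ i, DecidableEq (κ i)]
    {R : Type} [Zero R] (n : ι) (X : Matrix (κ n) (κ n) R) :
    Matrix (∀ i, κ i) (∀ i, κ i) R :=
  Matrix.of fun x y => if ∀ m, m ≠ n → x m = y m then X (x n) (y n) else 0

/-- Indices of the product basis of `H = ⨂ n, ℂ ^ (ℓ n + 1)`, where `ℓ n = 2 s_n` is twice the spin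
at site `n`. The same type indexes the multi-labels `h = (h_1, …, h_N)` with `0 ≤ h_n ≤ 2 s_n`. -/
abbrev Conf {N : ℕ} (ℓ : Fin N → ℕ) : Type := ∀ n : Fin N, Fin (ℓ n + 1)

/-- `End(H)`, as matrices in the product basis. -/
abbrev Op {N : ℕ} (ℓ : Fin N → ℕ) : Type := Matrix (Conf ℓ) (Conf ℓ) ℂ

/-- Covectors of `H`, as row vectors in the product basis. The action `⟨S| X` is `S ᵥ* X`. -/
abbrev Covec {N : ℕ} (ℓ : Fin N → ℕ) : Type := Conf ℓ → ℂ

/-- `S^z = diag(s, s - 1, …, -s)` for `2 s = m`. -/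
noncomputable def spinZ (m : ℕ) : Matrix (Fin (m + 1)) (Fin (m + 1)) ℂ :=
  Matrix.diagonal fun i => (m : ℂ) / 2 - (i : ℕ)

/-- `S^+`: the entry at (1-based) position `(j, j + 1)` is `√(j (2 s + 1 - j))`. -/
noncomputable def spinPlus (m : ℕ) : Matrix (Fin (m + 1)) (Fin (m + 1)) ℂ :=
  Matrix.of fun i j =>
    if (j : ℕ) = (i : ℕ) + 1 then
      ((Real.sqrt ((((i : ℕ) : ℝ) + 1) * ((m : ℝ) - ((i : ℕ) : ℝ))) : ℝ) : ℂ)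
    else 0

/-- `S^- = (S^+)^t`. -/
noncomputable def spinMinus (m : ℕ) : Matrix (Fin (m + 1)) (Fin (m + 1)) ℂ :=
  (spinPlus m).transpose

/-- The Lax operator of site `n`, a `2 × 2` matrix (auxiliary space) of operators on `H`. -/
noncomputable def lax {N : ℕ} (ℓ : Fin N → ℕ) (η : ℂ) (n : Fin N) (u : ℂ) :
    Matrix (Fin 2) (Fin 2) (Op ℓ) :=
  !![embedAt n ((u + η / 2) • (1 : Matrix (Fin (ℓ n + 1)) (Fin (ℓ n + 1)) ℂ) + η • spinZ (ℓ n)),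
      embedAt n (η • spinMinus (ℓ n));
    embedAt n (η • spinPlus (ℓ n)),
      embedAt n ((u + η / 2) • (1 : Matrix (Fin (ℓ n + 1)) (Fin (ℓ n + 1)) ℂ) - η • spinZ (ℓ n))]

/-- The monodromy matrix `M^{(K)}(u) = K L_N(u - ξ_N) ⋯ L_1(u - ξ_1)`. -/
noncomputable def monodromy {N : ℕ} (ℓ : Fin N → ℕ) (η : ℂ) (ξ : Fin N → ℂ)
    (K : Matrix (Fin 2) (Fin 2) ℂ) (u : ℂ) : Matrix (Fin 2) (Fin 2) (Op ℓ) :=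
  K.map (algebraMap ℂ (Op ℓ)) * (List.ofFn fun n => lax ℓ η n (u - ξ n)).reverse.prod

/-- The entry `A^{(K)}(u)` of the monodromy matrix. -/
noncomputable def opA {N : ℕ} (ℓ : Fin N → ℕ) (η : ℂ) (ξ : Fin N → ℂ)
    (K : Matrix (Fin 2) (Fin 2) ℂ) (u : ℂ) : Op ℓ :=
  monodromy ℓ η ξ K u 0 0

/-- The entry `B^{(K)}(u)` of the monodromy matrix. -/
noncomputable def opB {N : ℕ} (ℓ : Fin N → ℕ) (η : ℂ) (ξ : Fin N → ℂ)
    (K : Matrix (Fin 2) (Fin 2) ℂ) (u : ℂ) : Op ℓ :=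
  monodromy ℓ η ξ K u 0 1

/-- The permutation operator `v_1 ⊗ ⋯ ⊗ v_m ↦ v_{π 1} ⊗ ⋯ ⊗ v_{π m}` on `(ℂ²)^{⊗ m}`. -/
def permOp (m : ℕ) (π : Equiv.Perm (Fin m)) : Matrix (Fin m → Fin 2) (Fin m → Fin 2) ℂ :=
  Matrix.of fun x y => if x = y ∘ π then 1 else 0

/-- The symmetrizer `P^+` on `(ℂ²)^{⊗ m}`. -/
noncomputable def symProj (m : ℕ) : Matrix (Fin m → Fin 2) (Fin m → Fin 2) ℂ :=
  ((m.factorial : ℂ)⁻¹) • ∑ π : Equiv.Perm (Fin m), permOp m π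

/-- The fused monodromy matrix
`P^+ M_1(u + (m - 1) η) ⋯ M_{m-1}(u + η) M_m(u) P^+` on `(ℂ²)^{⊗ m} ⊗ H`. -/
noncomputable def fusedMonodromy {N : ℕ} (ℓ : Fin N → ℕ) (η : ℂ) (ξ : Fin N → ℂ)
    (K : Matrix (Fin 2) (Fin 2) ℂ) (m : ℕ) (u : ℂ) :
    Matrix (Fin m → Fin 2) (Fin m → Fin 2) (Op ℓ) :=
  (symProj m).map (algebraMap ℂ (Op ℓ)) *
    (List.ofFn fun k : Fin m =>
      embedAt (κ := fun _ : Fin m => Fin 2) k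
        (monodromy ℓ η ξ K (u + ((m : ℂ) - 1 - (k : ℕ)) * η))).prod *
    (symProj m).map (algebraMap ℂ (Op ℓ))

/-- The fused transfer matrix `T^{(K|m)}(u)`: the partial trace of the fused monodromy matrix over
the symmetric subspace of `(ℂ²)^{⊗ m}`. As the fused monodromy matrix vanishes on the complement
`ker P^+`, this is its partial trace over `(ℂ²)^{⊗ m}`. For `m = 0` it is the identity. -/
noncomputable def fusedTransfer {N : ℕ} (ℓ : Fin N → ℕ) (η : ℂ) (ξ : Fin N → ℂ)
    (K : Matrix (Fin 2) (Fin 2) ℂ) (m : ℕ) (u : ℂ) : Op ℓ :=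
  (fusedMonodromy ℓ η ξ K m u).trace

/-- The points `ξ_n^{(k)} = ξ_n - η / 2 + (s_n - k) η`. -/
noncomputable def node {N : ℕ} (ℓ : Fin N → ℕ) (η : ℂ) (ξ : Fin N → ℂ) (n : Fin N) (k : ℕ) : ℂ :=
  ξ n - η / 2 + ((ℓ n : ℂ) / 2 - (k : ℂ)) * η

/-- `a(u) = ∏_n (u - (ξ_n - η / 2) + s_n η)`. -/
noncomputable def funA {N : ℕ} (ℓ : Fin N → ℕ) (η : ℂ) (ξ : Fin N → ℂ) (u : ℂ) : ℂ :=
  ∏ n, (u - (ξ n - η / 2) + (ℓ n : ℂ) / 2 * η)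

/-- `d(u) = ∏_n (u - (ξ_n - η / 2) - s_n η)`. -/
noncomputable def funD {N : ℕ} (ℓ : Fin N → ℕ) (η : ℂ) (ξ : Fin N → ℂ) (u : ℂ) : ℂ :=
  ∏ n, (u - (ξ n - η / 2) - (ℓ n : ℂ) / 2 * η)

/-- The inhomogeneities are in separated position: the strings `{ξ_n^{(0)}, …, ξ_n^{(2 s_n)}}`
attached to different sites are disjoint. -/
def StringsDisjoint {N : ℕ} (ℓ : Fin N → ℕ) (η : ℂ) (ξ : Fin N → ℂ) : Prop :=
  ∀ n m : Fin N, n ≠ m → ∀ h ≤ ℓ n, ∀ h' ≤ ℓ m, node ℓ η ξ n h ≠ node ℓ η ξ m h'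

/-- A family of covectors indexed by the multi-labels `h` is a basis of the space of covectors. -/
def IsCovectorBasis {N : ℕ} {ℓ : Fin N → ℕ} (v : Conf ℓ → Covec ℓ) : Prop :=
  LinearIndependent ℂ v ∧ Submodule.span ℂ (Set.range v) = ⊤

/-- The covector
`⟨S| ∏_n k₂^{h_n - 2 s_n} T^{(K|2 s_n - h_n)}(ξ_n^{(2 s_n)}) / ∏_{k < 2 s_n - h_n} d(ξ_n^{(2 s_n - k)})`
(the factors commute; they are multiplied in the order of the sites). -/
noncomputable def sovCovec {N : ℕ} (ℓ : Fin N → ℕ) (η : ℂ) (ξ : Fin N → ℂ)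
    (K : Matrix (Fin 2) (Fin 2) ℂ) (k₂ : ℂ) (S : Covec ℓ) (h : Conf ℓ) : Covec ℓ :=
  Matrix.vecMul S
    (List.ofFn fun n : Fin N =>
      (k₂ ^ (((h n : ℕ) : ℤ) - (ℓ n : ℤ)) /
        ∏ k ∈ Finset.range (ℓ n - (h n : ℕ)), funD ℓ η ξ (node ℓ η ξ n (ℓ n - k))) •
      fusedTransfer ℓ η ξ K (ℓ n - (h n : ℕ)) (node ℓ η ξ n (ℓ n))).prod

/-- The left reference covector `⟨0| = ⨂_n (1, 0, …, 0)`. -/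
def refCovec {N : ℕ} (ℓ : Fin N → ℕ) : Covec ℓ := Pi.single (fun _ => 0) 1

/-- The normalization `∏_{b < a} (ξ_a^{(0)} - ξ_b^{(0)})^{1/2}`. -/
noncomputable def normConst {N : ℕ} (ℓ : Fin N → ℕ) (η : ℂ) (ξ : Fin N → ℂ) : ℂ :=
  ∏ a : Fin N, ∏ b ∈ Finset.Iio a, (node ℓ η ξ a 0 - node ℓ η ξ b 0) ^ (1 / 2 : ℂ)

/-- Sklyanin's covector
`⟨h|_Sk = n⁻¹ ⟨0| ∏_n ∏_{k < h_n} A^{(K)}(ξ_n^{(k)}) / (k₁ a(ξ_n^{(k)}))`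
(the factors commute; they are multiplied in the order of the sites and of `k`). -/
noncomputable def skCovec {N : ℕ} (ℓ : Fin N → ℕ) (η : ℂ) (ξ : Fin N → ℂ)
    (K : Matrix (Fin 2) (Fin 2) ℂ) (k₁ : ℂ) (h : Conf ℓ) : Covec ℓ :=
  (normConst ℓ η ξ)⁻¹ •
    Matrix.vecMul (refCovec ℓ)
      (List.ofFn fun n : Fin N =>
        (List.ofFn fun k : Fin (h n : ℕ) =>
          (k₁ * funA ℓ η ξ (node ℓ η ξ n k))⁻¹ • opA ℓ η ξ K (node ℓ η ξ n k)).prod).prod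

/-- The multi-label `h_n = 2 s_n` for all `n`. -/
def topConf {N : ℕ} (ℓ : Fin N → ℕ) : Conf ℓ := fun n => Fin.last (ℓ n)

/-- The `j`-th normalized symmetric vector of `(ℂ²)^{⊗ m}`: the sum of the basis words with exactly
`j` letters equal to the second basis vector, divided by `√(m choose j)`. For `j = 0, …, m` these
vectors identify `ℂ^{m+1}` with the symmetric subspace, compatibly with `S^z` and `S^±`. -/
noncomputable def symVec (m : ℕ) (j : Fin (m + 1)) (x : Fin m → Fin 2) : ℂ :=
  if (Finset.univ.filter fun k => x k = 1).card = (j : ℕ) then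
    (((Real.sqrt (m.choose (j : ℕ) : ℝ))⁻¹ : ℝ) : ℂ)
  else 0

/-- The fused matrix `W^{(m)}`: the restriction of `W ⊗ ⋯ ⊗ W` to the symmetric subspace of
`(ℂ²)^{⊗ m}`, in the orthonormal basis `symVec`. -/
noncomputable def fusedTwist (m : ℕ) (W : Matrix (Fin 2) (Fin 2) ℂ) :
    Matrix (Fin (m + 1)) (Fin (m + 1)) ℂ :=
  Matrix.of fun i j => ∑ x : Fin m → Fin 2, ∑ y : Fin m → Fin 2,
    symVec m i x * (∏ k, W (x k) (y k)) * symVec m j y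

/-- The operator `⨂_n W^{(2 s_n)}` on `H`. -/
noncomputable def globalTwist {N : ℕ} (ℓ : Fin N → ℕ) (W : Matrix (Fin 2) (Fin 2) ℂ) : Op ℓ :=
  Matrix.of fun x y => ∏ n, fusedTwist (ℓ n) W (x n) (y n)

/-- `K̄ = W⁻¹ K W`. -/
noncomputable def conjTwist (W K : Matrix (Fin 2) (Fin 2) ℂ) : Matrix (Fin 2) (Fin 2) ℂ :=
  W⁻¹ * K * W

/-- `B̃^{(K)}(u) = tr [W e₂₁ W⁻¹ M^{(K)}(u)]`, the trace being over the auxiliary space. -/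
noncomputable def opBTilde {N : ℕ} (ℓ : Fin N → ℕ) (η : ℂ) (ξ : Fin N → ℂ)
    (K W : Matrix (Fin 2) (Fin 2) ℂ) (u : ℂ) : Op ℓ :=
  ((W * !![0, 0; 1, 0] * W⁻¹).map (algebraMap ℂ (Op ℓ)) * monodromy ℓ η ξ K u).trace

/-- Sklyanin's covectors for the twist `K` with `b = 0`: those of `K̄ = W⁻¹ K W`, multiplied on the
right by the inverse of `⨂_n W^{(2 s_n)}`. -/
noncomputable def skCovecTilde {N : ℕ} (ℓ : Fin N → ℕ) (η : ℂ) (ξ : Fin N → ℂ)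
    (K W : Matrix (Fin 2) (Fin 2) ℂ) (k₁ : ℂ) (h : Conf ℓ) : Covec ℓ :=
  Matrix.vecMul (skCovec ℓ η ξ (conjTwist W K) k₁ h) (globalTwist ℓ W)⁻¹

/-! Two structures carry the proof: the Yang–Baxter relations `IsRTT` and the scalar quantum
determinant `HasQDet` of the monodromy matrix. Both pass from one site to products over sites
(`IsRTT.mul`, `HasQDet.mul`).

Suppose b ≠ 0. The covector ⟨0| is an eigencovector of B(u) with eigenvalue b d(u), whose zeros are
the points ξ_n^{(0)}. If an eigencovector has the zeros ξ_n^{(h_n)}, then B vanishes on it at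
ξ_n^{(h_n)}, and the exchange relations show that A(ξ_n^{(h_n)}) raises h_n by one
(`eigencovector_opA`). For the same reason the BC term of the quantum determinant drops out, so
D(ξ_n^{(h_n+1)}) undoes this step (`skLabel_vecMul_opD`). Going down to ⟨0| with nonzero
coefficients shows that Sklyanin's covectors do not vanish; as the strings are disjoint, their
B-eigenvalues are distinct polynomials, and they form a basis.

Fusion links this basis to the transfer matrices. Let h_n = 2s_n and w = ξ_n^{(2s_n)}. On such a
covector B(w) vanishes, and so does A(w), since its result would have label 2s_n + 1, which does not
occur in the spectrum of B. The Yang–Baxter relations let the symmetrized products of rows of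
M(w+(m-1)η) ⋯ M(w) start with a row of M(w) (`IsRTT.exists_rowPoly`). Hence every symmetrized row
word containing the upper row is killed, and T^{(K|m)}(w) acts as the product of D's
(`vecMul_fused_trace`), lowering h_n from 2s_n to 2s_n - m. The normalization cancels the
coefficients (`sovCovec_skCovec`).

If b = 0, the GL₂ covariance of the Lax operators conjugates all operators for K into those for
W⁻¹KW (`twist_mul_monodromy`, `twist_mul_fusedTransfer`), and the first case is transported. For
general S, the determinant of the family is a polynomial in S which is nonzero at the special
covector just found. -/

namespace SoV

/-! ### Yang–Baxter algebra and quantum determinant -/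

section RTT

variable {R : Type*} [Ring R] [Algebra ℂ R]

/-- The defining relations of the Yangian of `gl₂` for a `2 × 2` matrix `M` over `R`,
i.e. `R(u - v) M₁(u) M₂(v) = M₂(v) M₁(u) R(u - v)` with `R(u) = u + η P`. -/
def IsRTT (η : ℂ) (M : ℂ → Matrix (Fin 2) (Fin 2) R) : Prop :=
  ∀ (u v : ℂ) (i j k l : Fin 2),
    (u - v) • (M u i j * M v k l) + η • (M u k j * M v i l) =
      (u - v) • (M v k l * M u i j) + η • (M v k j * M u i l)

/-- The quantum determinant of `M` is the scalar function `q`. -/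
def HasQDet (η : ℂ) (M : ℂ → Matrix (Fin 2) (Fin 2) R) (q : ℂ → ℂ) : Prop :=
  ∀ u, M u 0 0 * M (u - η) 1 1 - M u 0 1 * M (u - η) 1 0 = algebraMap ℂ R (q u)

/-- Comultiplication of the Yangian. The relation of M is applied to the left factors and that of L
to the right ones; exchanging the summation indices p, q in the η-term (`mid`) passes from one to
the other. -/
theorem IsRTT.mul {η : ℂ} {M L : ℂ → Matrix (Fin 2) (Fin 2) R} (hM : IsRTT η M) (hL : IsRTT η L)
    (hc : ∀ u v i j k l, Commute (M u i j) (L v k l)) : IsRTT η fun u => M u * L u := by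
  intro u v i j k l
  have expand : ∀ (u v : ℂ) (i j k l : Fin 2), (M u * L u) i j * (M v * L v) k l =
      ∑ p, ∑ q, (M u i p * M v k q) * (L u p j * L v q l) := by
    intro u v i j k l
    rw [Matrix.mul_apply, Matrix.mul_apply, Finset.sum_mul_sum]
    refine Finset.sum_congr rfl fun p _ => Finset.sum_congr rfl fun q _ => ?_
    rw [mul_assoc, ← mul_assoc (L u p j), ← (hc v u k q p j).eq]
    simp only [mul_assoc]
  have lhs : (u - v) • ((M u * L u) i j * (M v * L v) k l) +
      η • ((M u * L u) k j * (M v * L v) i l) =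
      ∑ p, ∑ q, ((u - v) • (M u i p * M v k q) + η • (M u k p * M v i q)) *
        (L u p j * L v q l) := by
    rw [expand, expand, Finset.smul_sum, Finset.smul_sum, ← Finset.sum_add_distrib]
    refine Finset.sum_congr rfl fun p _ => ?_
    rw [Finset.smul_sum, Finset.smul_sum, ← Finset.sum_add_distrib]
    refine Finset.sum_congr rfl fun q _ => ?_
    rw [add_mul, smul_mul_assoc, smul_mul_assoc]
  have mid : ∑ p, ∑ q, ((u - v) • (M v k q * M u i p) + η • (M v k p * M u i q)) *
        (L u p j * L v q l) =
      ∑ p, ∑ q, (M v k q * M u i p) *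
        ((u - v) • (L u p j * L v q l) + η • (L u q j * L v p l)) := by
    have h1 : ∑ p, ∑ q, η • ((M v k p * M u i q) * (L u p j * L v q l)) =
        ∑ p, ∑ q, η • ((M v k q * M u i p) * (L u q j * L v p l)) := Finset.sum_comm
    simp only [add_mul, mul_add, Finset.sum_add_distrib, smul_mul_assoc, mul_smul_comm]
    rw [h1]
  have rhs : (u - v) • ((M v * L v) k l * (M u * L u) i j) +
      η • ((M v * L v) k j * (M u * L u) i l) =
      ∑ p, ∑ q, (M v k q * M u i p) *
        ((u - v) • (L v q l * L u p j) + η • (L v q j * L u p l)) := by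
    rw [expand, expand, Finset.sum_comm, Finset.sum_comm (f := fun p q =>
      M v k p * M u i q * (L v p j * L u q l)), Finset.smul_sum, Finset.smul_sum,
      ← Finset.sum_add_distrib]
    refine Finset.sum_congr rfl fun p _ => ?_
    rw [Finset.smul_sum, Finset.smul_sum, ← Finset.sum_add_distrib]
    refine Finset.sum_congr rfl fun q _ => ?_
    rw [mul_add, mul_smul_comm, mul_smul_comm]
  rw [lhs, rhs]
  simp_rw [hM u v]
  rw [mid]
  simp_rw [hL u v]

theorem IsRTT.const (η : ℂ) (K : Matrix (Fin 2) (Fin 2) ℂ) :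
    IsRTT η fun _ => K.map (algebraMap ℂ R) := by
  intro u v i j k l
  simp only [Matrix.map_apply]
  rw [Algebra.commutes (K i j), Algebra.commutes (K k j) (algebraMap ℂ R (K i l)),
    ← Algebra.commutes (K k j) (algebraMap ℂ R (K i l))]

theorem IsRTT.shift {η : ℂ} {M : ℂ → Matrix (Fin 2) (Fin 2) R} (hM : IsRTT η M) (c : ℂ) :
    IsRTT η fun u => M (u - c) := by
  intro u v i j k l
  simpa using hM (u - c) (v - c) i j k l

theorem IsRTT.map {S : Type*} [Ring S] [Algebra ℂ S] {η : ℂ} {M : ℂ → Matrix (Fin 2) (Fin 2) R}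
    (hM : IsRTT η M) (f : R →ₐ[ℂ] S) : IsRTT η fun u => (M u).map f := by
  intro u v i j k l
  simpa using congrArg f (hM u v i j k l)

theorem HasQDet.map {S : Type*} [Ring S] [Algebra ℂ S] {η : ℂ}
    {M : ℂ → Matrix (Fin 2) (Fin 2) R} {q : ℂ → ℂ}
    (hM : HasQDet η M q) (f : R →ₐ[ℂ] S) : HasQDet η (fun u => (M u).map f) q := by
  intro u
  simpa using congrArg f (hM u)

theorem HasQDet.shift {η : ℂ} {M : ℂ → Matrix (Fin 2) (Fin 2) R} {q : ℂ → ℂ}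
    (hM : HasQDet η M q) (c : ℂ) : HasQDet η (fun u => M (u - c)) fun u => q (u - c) := by
  intro u
  simpa [sub_right_comm] using hM (u - c)

theorem HasQDet.const (η : ℂ) (K : Matrix (Fin 2) (Fin 2) ℂ) :
    HasQDet η (fun _ => K.map (algebraMap ℂ R)) fun _ => K.det := by
  intro u
  simp [Matrix.det_fin_two]

/-- At u - v = η the R-matrix degenerates to η(1 + P). Within one row both relations then have the
same right-hand side. -/
theorem IsRTT.row {η : ℂ} (hη : η ≠ 0) {M : ℂ → Matrix (Fin 2) (Fin 2) R} (hM : IsRTT η M)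
    (u : ℂ) (i j l : Fin 2) : M u i j * M (u - η) i l = M u i l * M (u - η) i j := by
  have h1 := hM u (u - η) i j i l
  have h2 := hM u (u - η) i l i j
  simp only [sub_sub_cancel, ← smul_add] at h1 h2
  have h1 := smul_right_injective R hη h1
  have h2 := smul_right_injective R hη h2
  have h3 : (2 : ℂ) • (M u i j * M (u - η) i l) = (2 : ℂ) • (M u i l * M (u - η) i j) := by
    rw [two_smul, two_smul, h1, h2, add_comm]
  exact smul_right_injective R two_ne_zero h3

theorem IsRTT.antisymm {η : ℂ} (hη : η ≠ 0) {M : ℂ → Matrix (Fin 2) (Fin 2) R} (hM : IsRTT η M)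
    (u : ℂ) : M u 1 0 * M (u - η) 0 1 - M u 1 1 * M (u - η) 0 0 =
      -(M u 0 0 * M (u - η) 1 1 - M u 0 1 * M (u - η) 1 0) := by
  have h1 := hM u (u - η) 0 0 1 1
  have h2 := hM u (u - η) 0 1 1 0
  simp only [sub_sub_cancel, ← smul_add] at h1 h2
  have h1 := smul_right_injective R hη h1
  have h2 := smul_right_injective R hη h2
  rw [add_comm (M (u - η) 1 0 * M u 0 1), ← h1] at h2
  rw [neg_sub, sub_eq_sub_iff_add_eq_add, add_comm, ← h2, add_comm]

/-- As for the determinant of a product: grouped by the entries of M, the terms carry 2 × 2 minors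
of L. Those with equal rows vanish by `IsRTT.row`, and exchanging the rows changes the sign by
`IsRTT.antisymm`. -/
theorem HasQDet.mul {η : ℂ} (hη : η ≠ 0) {M L : ℂ → Matrix (Fin 2) (Fin 2) R} {p q : ℂ → ℂ}
    (hM : HasQDet η M p) (hL : HasQDet η L q) (hL' : IsRTT η L)
    (hc : ∀ u v i j k l, Commute (M u i j) (L v k l)) :
    HasQDet η (fun u => M u * L u) fun u => p u * q u := by
  intro u
  have e : ∀ i j k l p q, M u i p * L u p j * (M (u - η) k q * L (u - η) q l) =
      M u i p * M (u - η) k q * (L u p j * L (u - η) q l) := by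
    intro i j k l p q
    rw [mul_assoc, ← mul_assoc (L u p j), ← (hc (u - η) u k q p j).eq]
    simp only [mul_assoc]
  have h0 := hL'.row hη u 0 0 1
  have h1 := hL'.row hη u 1 0 1
  have h2 := hL'.antisymm hη u
  have h3 := hL u
  rw [h3] at h2
  simp only [Matrix.mul_apply, Fin.sum_univ_two, add_mul, mul_add, e]
  have : M u 0 0 * M (u - η) 1 0 * (L u 0 0 * L (u - η) 0 1) +
        M u 0 1 * M (u - η) 1 0 * (L u 1 0 * L (u - η) 0 1) +
      (M u 0 0 * M (u - η) 1 1 * (L u 0 0 * L (u - η) 1 1) +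
        M u 0 1 * M (u - η) 1 1 * (L u 1 0 * L (u - η) 1 1)) -
    (M u 0 0 * M (u - η) 1 0 * (L u 0 1 * L (u - η) 0 0) +
        M u 0 1 * M (u - η) 1 0 * (L u 1 1 * L (u - η) 0 0) +
      (M u 0 0 * M (u - η) 1 1 * (L u 0 1 * L (u - η) 1 0) +
        M u 0 1 * M (u - η) 1 1 * (L u 1 1 * L (u - η) 1 0))) =
      M u 0 0 * M (u - η) 1 0 * (L u 0 0 * L (u - η) 0 1 - L u 0 1 * L (u - η) 0 0) +
      M u 0 1 * M (u - η) 1 0 * (L u 1 0 * L (u - η) 0 1 - L u 1 1 * L (u - η) 0 0) +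
      M u 0 0 * M (u - η) 1 1 * (L u 0 0 * L (u - η) 1 1 - L u 0 1 * L (u - η) 1 0) +
      M u 0 1 * M (u - η) 1 1 * (L u 1 0 * L (u - η) 1 1 - L u 1 1 * L (u - η) 1 0) := by
    noncomm_ring
  rw [this, h2, h3, h0, h1, sub_self, sub_self, mul_zero, mul_zero, zero_add, add_zero, mul_neg,
    neg_add_eq_sub, ← sub_mul, hM u, map_mul]

end RTT

/-! ### Operators acting on one tensor factor -/

section Embed

variable {ι : Type} [Fintype ι] [DecidableEq ι] {κ : ι → Type} [∀ i, DecidableEq (κ i)]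

theorem embedAt_apply {R : Type} [Zero R] (n : ι) (X : Matrix (κ n) (κ n) R) (x y : ∀ i, κ i) :
    embedAt n X x y = if ∀ m, m ≠ n → x m = y m then X (x n) (y n) else 0 := rfl

theorem embedAt_eq_update {R : Type} [Zero R] (n : ι) (X : Matrix (κ n) (κ n) R)
    (x y : ∀ i, κ i) :
    embedAt n X x y = if y = Function.update x n (y n) then X (x n) (y n) else 0 := by
  rw [embedAt_apply]
  refine if_congr ⟨fun h => ?_, fun h m hm => ?_⟩ rfl rfl
  · funext m
    by_cases hm : m = n
    · subst hm; simp
    · simp [hm, h m hm]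
  · rw [h, Function.update_of_ne hm]

variable [∀ i, Fintype (κ i)]

theorem embedAt_mul_apply {R μ : Type} [NonUnitalNonAssocSemiring R] (n : ι)
    (X : Matrix (κ n) (κ n) R) (Z : Matrix (∀ i, κ i) μ R) (x : ∀ i, κ i) (y : μ) :
    (embedAt n X * Z) x y = ∑ c, X (x n) c * Z (Function.update x n c) y := by
  rw [Matrix.mul_apply]
  symm
  refine Finset.sum_of_injOn (fun c => Function.update x n c)
    (fun a _ b _ h => by simpa using congrFun h n) (by simp) (fun z _ hz => ?_) (fun c _ => ?_)
  · rw [embedAt_eq_update, if_neg, zero_mul]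
    intro h
    exact hz ⟨z n, by simp, h.symm⟩
  · rw [embedAt_eq_update]; simp

theorem embedAt_prod_apply {R : Type} [Ring R] (X : ∀ n, Matrix (κ n) (κ n) R) (l : List ι)
    (hl : l.Nodup) (x y : ∀ i, κ i) :
    (l.map fun n => embedAt n (X n)).prod x y =
      if ∀ m, m ∉ l → x m = y m then (l.map fun n => X n (x n) (y n)).prod else 0 := by
  induction l generalizing x with
  | nil => simp [Matrix.one_apply, funext_iff]
  | cons a l ih =>
    rw [List.nodup_cons] at hl
    rw [List.map_cons, List.prod_cons, embedAt_mul_apply, Finset.sum_eq_single (y a)]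
    · rw [ih hl.2]
      have h1 : (∀ m, m ∉ l → Function.update x a (y a) m = y m) ↔
          ∀ m, m ∉ a :: l → x m = y m := by
        refine forall_congr' fun m => ?_
        by_cases hm : m = a
        · subst hm; simp
        · simp [hm]
      have h2 : (l.map fun n => X n (Function.update x a (y a) n) (y n)) =
          l.map fun n => X n (x n) (y n) :=
        List.map_congr_left fun m hm => by
          rw [Function.update_of_ne]
          rintro rfl
          exact hl.1 hm
      rw [if_congr h1 rfl rfl, h2, mul_ite, mul_zero, List.map_cons, List.prod_cons]
    · intro c _ hc
      rw [ih hl.2, if_neg, mul_zero]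
      intro h
      exact hc (by simpa using h a hl.1)
    · simp

theorem embedAt_mul {R : Type} [NonUnitalNonAssocSemiring R] (n : ι)
    (X Y : Matrix (κ n) (κ n) R) : embedAt n (X * Y) = embedAt n X * embedAt n Y := by
  ext x y
  rw [embedAt_mul_apply, embedAt_apply, Matrix.mul_apply]
  have : ∀ c, (∀ m, m ≠ n → Function.update x n c m = y m) ↔ ∀ m, m ≠ n → x m = y m := by
    intro c
    refine forall_congr' fun m => forall_congr' fun hm => ?_
    rw [Function.update_of_ne hm]
  simp only [embedAt_apply, this, Function.update_self]
  split_ifs <;> simp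

theorem embedAt_commute {R : Type} [Ring R] {n m : ι} (h : n ≠ m)
    (X : Matrix (κ n) (κ n) R) (Y : Matrix (κ m) (κ m) R)
    (hc : ∀ i j k l, Commute (X i j) (Y k l)) : Commute (embedAt n X) (embedAt m Y) := by
  -- Only the values at n and m matter; the family serves to compute both orders of the product by
  -- `embedAt_prod_apply`.
  let Z : ∀ i, Matrix (κ i) (κ i) R := Function.update (Function.update (fun _ => 0) m Y) n X
  have hn : Z n = X := by simp [Z]
  have hm : Z m = Y := by simp [Z, h.symm]
  ext x y
  have h1 := embedAt_prod_apply Z [n, m] (by simp [h]) x y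
  have h2 := embedAt_prod_apply Z [m, n] (by simp [h.symm]) x y
  simp only [List.map_cons, List.map_nil, List.prod_cons, List.prod_nil, mul_one, hn, hm] at h1 h2
  rw [h1, h2, (hc (x n) (y n) (x m) (y m)).eq]
  refine if_congr (forall_congr' fun k => ?_) rfl rfl
  simp [and_comm]

/-- `embedAt n` as a homomorphism of algebras. -/
def embedHom (n : ι) : Matrix (κ n) (κ n) ℂ →ₐ[ℂ] Matrix (∀ i, κ i) (∀ i, κ i) ℂ :=
  AlgHom.ofLinearMap
    { toFun := embedAt n
      map_add' := fun X Y => by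
        ext x y
        simp only [embedAt_apply, Matrix.add_apply]
        split_ifs <;> simp
      map_smul' := fun c X => by
        ext x y
        simp only [embedAt_apply, Matrix.smul_apply]
        split_ifs <;> simp }
    (by
      ext x y
      simp only [LinearMap.coe_mk, AddHom.coe_mk, embedAt_eq_update, Matrix.one_apply]
      by_cases h : x = y
      · subst h; simp
      · rw [if_neg h]
        split_ifs with h1 h2
        · rw [← h2, Function.update_eq_self] at h1
          exact absurd h1.symm h
        · rfl
        · rfl)
    (fun X Y => embedAt_mul n X Y)

theorem embedHom_apply (n : ι) (X : Matrix (κ n) (κ n) ℂ) : embedHom n X = embedAt n X := rfl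

end Embed

/-! ### The Lax operator of a single site -/

section LocalLax

theorem ofReal_sqrt_sq {x : ℝ} (hx : 0 ≤ x) : ((√x : ℝ) : ℂ) * ((√x : ℝ) : ℂ) = x := by
  rw [← Complex.ofReal_mul, Real.mul_self_sqrt hx]

theorem spinPlus_apply (m : ℕ) (i j : Fin (m + 1)) : spinPlus m i j =
    if (j : ℕ) = (i : ℕ) + 1 then
      ((Real.sqrt ((((i : ℕ) : ℝ) + 1) * ((m : ℝ) - ((i : ℕ) : ℝ))) : ℝ) : ℂ)
    else 0 := rfl

theorem spinPlus_mul_spinMinus (m : ℕ) : spinPlus m * spinMinus m =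
    Matrix.diagonal fun i : Fin (m + 1) => (((i : ℕ) : ℂ) + 1) * ((m : ℂ) - ((i : ℕ) : ℂ)) := by
  ext i j
  have him : ((i : ℕ) : ℝ) ≤ m := by exact_mod_cast Nat.lt_succ_iff.mp i.2
  simp only [Matrix.mul_apply, spinMinus, Matrix.transpose_apply, spinPlus_apply,
    Matrix.diagonal_apply]
  split_ifs with hij
  · subst hij
    by_cases hi : (i : ℕ) + 1 < m + 1
    · rw [Finset.sum_eq_single ⟨(i : ℕ) + 1, hi⟩]
      · simp only [if_true]
        rw [ofReal_sqrt_sq (by have := sub_nonneg.mpr him; positivity)]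
        push_cast; ring
      · intro b _ hb
        rw [if_neg, zero_mul]
        intro h; exact hb (Fin.ext h)
      · simp
    · have : (i : ℕ) = m := by have := i.2; omega
      have e : (m : ℂ) - ((i : ℕ) : ℂ) = 0 := by rw [this, sub_self]
      rw [e, mul_zero]
      refine Finset.sum_eq_zero fun k _ => ?_
      rw [if_neg, zero_mul]
      have := k.2; omega
  · refine Finset.sum_eq_zero fun k _ => ?_
    by_cases h : (k : ℕ) = (i : ℕ) + 1
    · rw [if_neg (c := (k : ℕ) = (j : ℕ) + 1), mul_zero]
      intro h'; exact hij (Fin.ext (by omega))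
    · rw [if_neg h, zero_mul]

theorem spinMinus_mul_spinPlus (m : ℕ) : spinMinus m * spinPlus m =
    Matrix.diagonal fun i : Fin (m + 1) => ((i : ℕ) : ℂ) * ((m : ℂ) + 1 - ((i : ℕ) : ℂ)) := by
  ext i j
  simp only [Matrix.mul_apply, spinMinus, Matrix.transpose_apply, spinPlus_apply,
    Matrix.diagonal_apply]
  split_ifs with hij
  · subst hij
    by_cases hi : (i : ℕ) = 0
    · rw [hi, Nat.cast_zero, zero_mul]
      refine Finset.sum_eq_zero fun k _ => ?_
      rw [if_neg, zero_mul]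
      omega
    · have hi' : (i : ℕ) - 1 < m + 1 := by have := i.2; omega
      rw [Finset.sum_eq_single ⟨(i : ℕ) - 1, hi'⟩]
      · have e : (i : ℕ) = (i : ℕ) - 1 + 1 := by omega
        have him : (((i : ℕ) - 1 : ℕ) : ℝ) ≤ m := by
          have := i.2
          exact_mod_cast (by omega : (i : ℕ) - 1 ≤ m)
        simp only [if_pos e]
        rw [ofReal_sqrt_sq (by have := sub_nonneg.mpr him; positivity), e]
        push_cast; simp
      · intro b _ hb
        rw [if_neg, zero_mul]
        intro h; exact hb (Fin.ext (by simp only; omega))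
      · simp
  · refine Finset.sum_eq_zero fun k _ => ?_
    by_cases h : (i : ℕ) = (k : ℕ) + 1
    · rw [if_neg (c := (j : ℕ) = (k : ℕ) + 1), mul_zero]
      intro h'; exact hij (Fin.ext (by omega))
    · rw [if_neg h, zero_mul]

theorem spinZ_mul_spinPlus (m : ℕ) :
    spinZ m * spinPlus m = spinPlus m * spinZ m + spinPlus m := by
  ext i j
  simp only [spinZ, Matrix.diagonal_mul, Matrix.mul_diagonal, Matrix.add_apply, spinPlus_apply]
  split_ifs with h
  · rw [h]; push_cast; ring
  · simp

theorem spinZ_mul_spinMinus (m : ℕ) :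
    spinZ m * spinMinus m = spinMinus m * spinZ m - spinMinus m := by
  have h := congrArg Matrix.transpose (spinZ_mul_spinPlus m)
  rw [Matrix.transpose_add, Matrix.transpose_mul, Matrix.transpose_mul,
    show (spinZ m).transpose = spinZ m from Matrix.diagonal_transpose _] at h
  change spinMinus m * spinZ m = spinZ m * spinMinus m + spinMinus m at h
  rw [h, add_sub_cancel_right]

theorem spinPlus_comm_spinMinus (m : ℕ) :
    spinPlus m * spinMinus m = spinMinus m * spinPlus m + (2 : ℂ) • spinZ m := by
  rw [spinPlus_mul_spinMinus, spinMinus_mul_spinPlus, spinZ, ← Matrix.diagonal_smul,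
    Matrix.diagonal_add]
  congr 1
  funext i
  simp only [Pi.smul_apply, smul_eq_mul]
  ring

/-- The Lax operator of a single site, with entries in the operators on `ℂ ^ (m + 1)`. -/
noncomputable def localLax (m : ℕ) (η u : ℂ) :
    Matrix (Fin 2) (Fin 2) (Matrix (Fin (m + 1)) (Fin (m + 1)) ℂ) :=
  !![(u + η / 2) • 1 + η • spinZ m, η • spinMinus m;
    η • spinPlus m, (u + η / 2) • 1 - η • spinZ m]

theorem lax_eq_map {N : ℕ} (ℓ : Fin N → ℕ) (η : ℂ) (n : Fin N) (u : ℂ) :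
    lax ℓ η n u = (localLax (ℓ n) η u).map (embedHom (κ := fun n => Fin (ℓ n + 1)) n) := by
  ext i j : 2
  fin_cases i <;> fin_cases j <;> rfl

theorem isRTT_localLax (m : ℕ) (η : ℂ) : IsRTT η (localLax m η) := by
  have h1 := spinZ_mul_spinPlus m
  have h2 := spinZ_mul_spinMinus m
  have h3 := spinPlus_comm_spinMinus m
  intro u v i j k l
  fin_cases i <;> fin_cases j <;> fin_cases k <;> fin_cases l <;>
  simp only [localLax, Fin.zero_eta, Fin.mk_one, Fin.isValue, Matrix.of_apply, Matrix.cons_val',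
    Matrix.cons_val_zero, Matrix.cons_val_one, Matrix.cons_val_fin_one, add_mul, mul_add, sub_mul,
    mul_sub, smul_mul_assoc, mul_smul_comm, one_mul, mul_one, h1, h2, h3] <;> module

/-- The quantum determinant is scalar because S⁻S⁺ is an explicit quadratic polynomial in S^z,
namely the Casimir relation. -/
theorem hasQDet_localLax (m : ℕ) (η : ℂ) : HasQDet η (localLax m η) fun u =>
    (u + η / 2 + (m : ℂ) / 2 * η) * (u - η / 2 - (m : ℂ) / 2 * η) := by
  intro u
  have h := spinMinus_mul_spinPlus m
  simp only [localLax, Matrix.of_apply, Matrix.cons_val', Matrix.cons_val_zero,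
    Matrix.cons_val_one, Matrix.cons_val_fin_one, smul_mul_assoc, mul_smul_comm, h]
  rw [← Matrix.diagonal_one, spinZ]
  simp only [← Matrix.diagonal_smul, Matrix.diagonal_add, Matrix.diagonal_sub,
    Matrix.diagonal_mul_diagonal, Matrix.algebraMap_eq_diagonal]
  congr 1
  funext i
  simp
  ring

end LocalLax

/-! ### Yang–Baxter relations and quantum determinant of the monodromy matrix -/

section Monodromy

theorem commute_map_algebraMap {R : Type*} [Ring R] [Algebra ℂ R] (K : Matrix (Fin 2) (Fin 2) ℂ)
    (i j : Fin 2) (x : R) : Commute (K.map (algebraMap ℂ R) i j) x :=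
  Algebra.commute_algebraMap_left _ _

variable {N : ℕ} (ℓ : Fin N → ℕ) (η : ℂ) (ξ : Fin N → ℂ)

/-- The ordered product of the Lax operators of the sites in a list. -/
noncomputable def laxProd (l : List (Fin N)) (u : ℂ) : Matrix (Fin 2) (Fin 2) (Op ℓ) :=
  (l.map fun n => lax ℓ η n (u - ξ n)).prod

theorem monodromy_eq (K : Matrix (Fin 2) (Fin 2) ℂ) (u : ℂ) : monodromy ℓ η ξ K u =
    K.map (algebraMap ℂ (Op ℓ)) * laxProd ℓ η ξ (List.finRange N).reverse u := by
  rw [monodromy, laxProd, List.ofFn_eq_map, ← List.map_reverse]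

theorem laxProd_cons (n : Fin N) (l : List (Fin N)) (u : ℂ) :
    laxProd ℓ η ξ (n :: l) u = lax ℓ η n (u - ξ n) * laxProd ℓ η ξ l u := by
  simp [laxProd]

theorem laxProd_nil : laxProd ℓ η ξ [] = fun _ => (1 : Matrix (Fin 2) (Fin 2) ℂ).map
    (algebraMap ℂ (Op ℓ)) := by
  funext u
  simp [laxProd]

variable {η ξ} in
theorem commute_lax_laxProd {n : Fin N} {l : List (Fin N)} (hn : n ∉ l) (u v : ℂ)
    (i j k p : Fin 2) : Commute (lax ℓ η n u i j) (laxProd ℓ η ξ l v k p) := by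
  induction l generalizing k p with
  | nil =>
    rw [laxProd_nil]
    exact (commute_map_algebraMap _ _ _ _).symm
  | cons m l ih =>
    rw [List.mem_cons, not_or] at hn
    rw [laxProd_cons, Matrix.mul_apply]
    refine Commute.sum_right _ _ _ fun q _ => Commute.mul_right ?_ (ih hn.2 q p)
    rw [lax_eq_map, lax_eq_map]
    exact embedAt_commute hn.1 _ _ fun _ _ _ _ => Commute.all _ _

theorem isRTT_lax (n : Fin N) : IsRTT η fun u => lax ℓ η n (u - ξ n) := by
  simp_rw [lax_eq_map]
  exact ((isRTT_localLax (ℓ n) η).map _).shift (ξ n)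

theorem hasQDet_lax (n : Fin N) : HasQDet η (fun u => lax ℓ η n (u - ξ n)) fun u =>
    (u - ξ n + η / 2 + (ℓ n : ℂ) / 2 * η) * (u - ξ n - η / 2 - (ℓ n : ℂ) / 2 * η) := by
  simp_rw [lax_eq_map]
  exact ((hasQDet_localLax (ℓ n) η).map _).shift (ξ n)

theorem isRTT_laxProd {l : List (Fin N)} (hl : l.Nodup) : IsRTT η (laxProd ℓ η ξ l) := by
  induction l with
  | nil =>
    rw [laxProd_nil]
    exact IsRTT.const η 1
  | cons n l ih =>
    rw [List.nodup_cons] at hl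
    rw [show laxProd ℓ η ξ (n :: l) = _ from funext (laxProd_cons ℓ η ξ n l)]
    exact (isRTT_lax ℓ η ξ n).mul (ih hl.2) fun u v i j k p =>
      commute_lax_laxProd ℓ hl.1 _ _ _ _ _ _

variable {η} in
theorem hasQDet_laxProd (hη : η ≠ 0) {l : List (Fin N)} (hl : l.Nodup) :
    HasQDet η (laxProd ℓ η ξ l) fun u => (l.map fun n =>
      (u - ξ n + η / 2 + (ℓ n : ℂ) / 2 * η) * (u - ξ n - η / 2 - (ℓ n : ℂ) / 2 * η)).prod := by
  induction l with
  | nil =>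
    rw [laxProd_nil]
    simpa using HasQDet.const (R := Op ℓ) η 1
  | cons n l ih =>
    rw [List.nodup_cons] at hl
    rw [show laxProd ℓ η ξ (n :: l) = _ from funext (laxProd_cons ℓ η ξ n l)]
    simp only [List.map_cons, List.prod_cons]
    exact (hasQDet_lax ℓ η ξ n).mul hη (ih hl.2) (isRTT_laxProd ℓ η ξ hl.2)
      fun u v i j k p => commute_lax_laxProd ℓ hl.1 _ _ _ _ _ _

theorem nodup_reverse_finRange : (List.finRange N).reverse.Nodup :=
  List.nodup_reverse.mpr (List.nodup_finRange N)

theorem isRTT_monodromy (K : Matrix (Fin 2) (Fin 2) ℂ) : IsRTT η (monodromy ℓ η ξ K) := by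
  rw [show monodromy ℓ η ξ K = _ from funext (monodromy_eq ℓ η ξ K)]
  exact (IsRTT.const η K).mul (isRTT_laxProd ℓ η ξ nodup_reverse_finRange)
    fun u v i j k p => commute_map_algebraMap _ _ _ _

variable {η} in
theorem hasQDet_monodromy (hη : η ≠ 0) (K : Matrix (Fin 2) (Fin 2) ℂ) :
    HasQDet η (monodromy ℓ η ξ K) fun u => K.det * (funA ℓ η ξ u * funD ℓ η ξ (u - η)) := by
  rw [show monodromy ℓ η ξ K = _ from funext (monodromy_eq ℓ η ξ K)]
  have h := (HasQDet.const (R := Op ℓ) η K).mul hη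
    (hasQDet_laxProd ℓ ξ hη nodup_reverse_finRange)
    (isRTT_laxProd ℓ η ξ nodup_reverse_finRange) fun u v i j k p => commute_map_algebraMap _ _ _ _
  convert h using 3 with u
  rw [List.map_reverse, List.prod_reverse, ← List.ofFn_eq_map, List.prod_ofFn, funA, funD,
    ← Finset.prod_mul_distrib]
  exact Finset.prod_congr rfl fun n _ => by ring

end Monodromy

/-! ### The reference covector -/

section Reference

variable {N : ℕ} (ℓ : Fin N → ℕ) (η : ℂ) (ξ : Fin N → ℂ)

theorem refCovec_vecMul_embedAt (n : Fin N) (X : Matrix (Fin (ℓ n + 1)) (Fin (ℓ n + 1)) ℂ)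
    (c : ℂ) (hX : ∀ j, X 0 j = if j = 0 then c else 0) :
    Matrix.vecMul (refCovec ℓ) (embedAt (κ := fun n => Fin (ℓ n + 1)) n X) =
      c • refCovec ℓ := by
  rw [refCovec, Matrix.single_one_vecMul]
  funext y
  simp only [Matrix.row_apply, embedAt_eq_update, hX, Pi.smul_apply, Pi.single_apply, smul_eq_mul,
    mul_ite, mul_one, mul_zero]
  by_cases h : y = fun _ => 0
  · subst h
    simp
  · rw [if_neg h, ← ite_and, if_neg]
    rintro ⟨h1, h2⟩
    rw [h2, Function.update_eq_self_iff.mpr rfl] at h1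
    exact h h1

theorem refCovec_lax (n : Fin N) (u : ℂ) :
    Matrix.vecMul (refCovec ℓ) (lax ℓ η n u 0 0) =
      (u + η / 2 + (ℓ n : ℂ) / 2 * η) • refCovec ℓ ∧
    Matrix.vecMul (refCovec ℓ) (lax ℓ η n u 0 1) = 0 ∧
    Matrix.vecMul (refCovec ℓ) (lax ℓ η n u 1 1) =
      (u + η / 2 - (ℓ n : ℂ) / 2 * η) • refCovec ℓ := by
  refine ⟨?_, ?_, ?_⟩
  · refine refCovec_vecMul_embedAt ℓ n _ _ fun j => ?_
    simp only [Matrix.add_apply, Matrix.smul_apply, Matrix.one_apply, spinZ,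
      Matrix.diagonal_apply, smul_eq_mul, eq_comm (a := (0 : Fin (ℓ n + 1)))]
    split_ifs
    · simp; ring
    · simp
  · rw [← zero_smul ℂ (refCovec ℓ)]
    refine refCovec_vecMul_embedAt ℓ n _ 0 fun j => ?_
    simp [spinMinus, spinPlus]
  · refine refCovec_vecMul_embedAt ℓ n _ _ fun j => ?_
    simp only [Matrix.sub_apply, Matrix.smul_apply, Matrix.one_apply, spinZ,
      Matrix.diagonal_apply, smul_eq_mul, eq_comm (a := (0 : Fin (ℓ n + 1)))]
    split_ifs
    · simp; ring
    · simp

/-- ⟨0| kills S⁻ at every site, so on it each Lax operator is triangular in the auxiliary space. -/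
theorem refCovec_laxProd {l : List (Fin N)} (hl : l.Nodup) (u : ℂ) :
    Matrix.vecMul (refCovec ℓ) (laxProd ℓ η ξ l u 0 1) = 0 ∧
    Matrix.vecMul (refCovec ℓ) (laxProd ℓ η ξ l u 1 1) =
      (l.map fun n => u - ξ n + η / 2 - (ℓ n : ℂ) / 2 * η).prod • refCovec ℓ := by
  induction l with
  | nil => simp [laxProd]
  | cons n l ih =>
    rw [List.nodup_cons] at hl
    obtain ⟨h0, h1, h2⟩ := refCovec_lax ℓ η n (u - ξ n)
    obtain ⟨h3, h4⟩ := ih hl.2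
    -- ⟨0| is no eigencovector of the lower left entry at n; this entry is moved past the upper
    -- right entry of the remaining product, which kills ⟨0|.
    have hc := commute_lax_laxProd ℓ hl.1 (u - ξ n) u (η := η) (ξ := ξ) 1 0 0 1
    simp only [laxProd_cons, Matrix.mul_apply, Fin.sum_univ_two, hc.eq, Matrix.vecMul_add,
      ← Matrix.vecMul_vecMul, h0, h1, h2, h3, h4, Matrix.smul_vecMul, Matrix.zero_vecMul,
      smul_zero, add_zero, zero_add, smul_smul, List.map_cons, List.prod_cons, and_self]

theorem refCovec_opB (K : Matrix (Fin 2) (Fin 2) ℂ) (u : ℂ) :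
    Matrix.vecMul (refCovec ℓ) (opB ℓ η ξ K u) = (K 0 1 * funD ℓ η ξ u) • refCovec ℓ := by
  obtain ⟨h1, h2⟩ := refCovec_laxProd ℓ η ξ nodup_reverse_finRange u
  have hd : ((List.finRange N).reverse.map fun n =>
      u - ξ n + η / 2 - (ℓ n : ℂ) / 2 * η).prod = funD ℓ η ξ u := by
    rw [List.map_reverse, List.prod_reverse, ← List.ofFn_eq_map, List.prod_ofFn, funD]
    exact Finset.prod_congr rfl fun n _ => by ring
  rw [opB, monodromy_eq, Matrix.mul_apply, Fin.sum_univ_two]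
  simp only [Matrix.map_apply, ← Algebra.smul_def, Matrix.vecMul_add, Matrix.vecMul_smul, h1, h2,
    smul_zero, zero_add, smul_smul, hd]

end Reference

/-! ### Exchange relations on covectors -/

section Exchange

/-- The relation multiplies the commutator by u - v + η, and by v - u + η after exchanging u and v.
Either factor may vanish, but their sum is 2η. -/
theorem IsRTT.commute_diag {R : Type*} [Ring R] [Algebra ℂ R] {η : ℂ} (hη : η ≠ 0)
    {M : ℂ → Matrix (Fin 2) (Fin 2) R} (hM : IsRTT η M) (i : Fin 2) (u v : ℂ) :
    Commute (M u i i) (M v i i) := by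
  have h1 := hM u v i i i i
  have h2 := hM v u i i i i
  have h3 : (2 * η) • (M u i i * M v i i) = (2 * η) • (M v i i * M u i i) := by
    have : (2 * η) = (u - v + η) + (v - u + η) := by ring
    rw [← add_smul, ← add_smul] at h1 h2
    rw [this, add_smul, h1, ← h2, ← add_smul]
  exact smul_right_injective R (mul_ne_zero two_ne_zero hη) h3

variable {n : Type*} [Fintype n] [DecidableEq n] {η : ℂ}
  {M : ℂ → Matrix (Fin 2) (Fin 2) (Matrix n n ℂ)}

/-- Two exchange relations applied to v contain the unwanted covector v A(w) B(u); eliminating it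
gives the claim. The factor u - w stays on the left, so that u = w is allowed. -/
theorem IsRTT.vecMul_A_vecMul_B (hη : η ≠ 0) (hM : IsRTT η M) {v : n → ℂ} {u w β : ℂ}
    (hu : Matrix.vecMul v (M u 0 1) = 0) (hw : Matrix.vecMul v (M w 0 1) = β • v) :
    (u - w) • Matrix.vecMul (Matrix.vecMul v (M u 0 0)) (M w 0 1) =
      ((u - w - η) * β) • Matrix.vecMul v (M u 0 0) := by
  have h1 := congrArg (Matrix.vecMul v) (hM w u 0 0 0 1)
  have h2 := congrArg (Matrix.vecMul v) (hM u w 0 1 0 0)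
  simp only [Matrix.vecMul_add, Matrix.vecMul_smul, ← Matrix.vecMul_vecMul, hu, hw,
    Matrix.zero_vecMul, smul_zero, zero_add, Matrix.smul_vecMul] at h1 h2
  have h3 : η • ((u - w) • Matrix.vecMul (Matrix.vecMul v (M u 0 0)) (M w 0 1)) =
      η • (((u - w - η) * β) • Matrix.vecMul v (M u 0 0)) := by
    rw [smul_comm, ← h1, smul_add, smul_comm (u - w) (w - u), smul_comm (u - w) η,
      eq_neg_of_add_eq_zero_left h2.symm]
    module
  exact smul_right_injective _ hη h3

theorem HasQDet.vecMul_A_vecMul_D {q : ℂ → ℂ} (hM : HasQDet η M q) {v : n → ℂ} {u : ℂ}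
    (hu : Matrix.vecMul v (M u 0 1) = 0) :
    Matrix.vecMul (Matrix.vecMul v (M u 0 0)) (M (u - η) 1 1) = q u • v := by
  have h := congrArg (Matrix.vecMul v) (hM u)
  rw [Algebra.algebraMap_eq_smul_one, Matrix.vecMul_smul, Matrix.vecMul_one,
    Matrix.vecMul_sub, ← Matrix.vecMul_vecMul, ← Matrix.vecMul_vecMul, hu, Matrix.zero_vecMul,
    sub_zero] at h
  exact h

end Exchange

/-- Joint eigenvectors with pairwise distinct eigenvalues are linearly independent. -/
theorem linearIndependent_of_joint_eigenvectors {ι α 𝕜 V : Type*} [Field 𝕜] [AddCommGroup V]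
    [Module 𝕜 V] (f : α → V →ₗ[𝕜] V) (v : ι → V) (μ : α → ι → 𝕜)
    (hf : ∀ a i, f a (v i) = μ a i • v i) (hμ : ∀ i j, i ≠ j → ∃ a, μ a i ≠ μ a j)
    (hv : ∀ i, v i ≠ 0) : LinearIndependent 𝕜 v := by
  classical
  rw [linearIndependent_iff']
  intro s
  induction s using Finset.strongInduction with
  | H s ih =>
    intro g hg i hi
    by_cases hs : ∃ j ∈ s, j ≠ i
    · obtain ⟨j, hj, hji⟩ := hs
      obtain ⟨a, ha⟩ := hμ i j hji.symm
      have h1 : ∑ k ∈ s, (g k * (μ a k - μ a j)) • v k = 0 := by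
        have h2 := congrArg (f a) hg
        simp only [map_sum, map_smul, hf, map_zero] at h2
        calc ∑ k ∈ s, (g k * (μ a k - μ a j)) • v k
            = ∑ k ∈ s, g k • μ a k • v k - μ a j • ∑ k ∈ s, g k • v k := by
              rw [Finset.smul_sum, ← Finset.sum_sub_distrib]
              exact Finset.sum_congr rfl fun k _ => by module
          _ = 0 := by rw [h2, hg, smul_zero, sub_zero]
      rw [← Finset.add_sum_erase _ _ hj, sub_self, mul_zero, zero_smul, zero_add] at h1
      have h3 := ih _ (Finset.erase_ssubset hj) _ h1 i (Finset.mem_erase.mpr ⟨hji.symm, hi⟩)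
      exact (mul_eq_zero.mp h3).resolve_right (sub_ne_zero.mpr ha)
    · push Not at hs
      have : s = {i} := Finset.eq_singleton_iff_unique_mem.mpr ⟨hi, hs⟩
      rw [this, Finset.sum_singleton] at hg
      exact (smul_eq_zero.mp hg).resolve_right (hv i)

theorem prod_ofFn_update_mul {R : Type*} [Monoid R] {N : ℕ} (f : Fin N → R) (n : Fin N) (x : R)
    (hx : ∀ m, Commute (f m) x) :
    (List.ofFn (Function.update f n (f n * x))).prod = (List.ofFn f).prod * x := by
  induction N with
  | zero => exact n.elim0
  | succ N ih =>
    have hc : ∀ g : Fin N → R, (∀ m, Commute (g m) x) → Commute (List.ofFn g).prod x := by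
      intro g hg
      refine Commute.list_prod_left _ _ fun y hy => ?_
      obtain ⟨m, rfl⟩ := (List.mem_ofFn' _ _).mp hy
      exact hg m
    simp only [List.ofFn_succ, List.prod_cons]
    refine Fin.cases ?_ (fun n => ?_) n
    · have h0 : (fun i : Fin N => Function.update f 0 (f 0 * x) i.succ) = fun i => f i.succ := by
        funext i
        rw [Function.update_of_ne (Fin.succ_ne_zero i)]
      rw [Function.update_self, h0, mul_assoc, mul_assoc,
        (hc (fun i => f i.succ) fun m => hx _).eq]
    · have h0 : (fun i : Fin N => Function.update f n.succ (f n.succ * x) i.succ) =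
          Function.update (fun i => f i.succ) n ((fun i : Fin N => f i.succ) n * x) := by
        funext i
        by_cases h : i = n
        · subst h; simp
        · simp [h]
      rw [Function.update_of_ne (Fin.succ_ne_zero n).symm, h0,
        ih (fun i => f i.succ) n fun m => hx _, mul_assoc]

theorem multilabel_induction {N : ℕ} {P : (Fin N → ℕ) → Prop} (h0 : P fun _ => 0)
    (hs : ∀ h n, P h → P (Function.update h n (h n + 1))) (h : Fin N → ℕ) : P h := by
  generalize hm : ∑ n, h n = m
  induction m generalizing h with
  | zero =>
    have : h = fun _ => 0 := funext fun n => by simpa using (Finset.sum_eq_zero_iff.mp hm) n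
    rwa [this]
  | succ m ih =>
    obtain ⟨n, hn⟩ : ∃ n, h n ≠ 0 := by
      by_contra! hcon
      simp [hcon] at hm
    have h1 : h = Function.update (Function.update h n (h n - 1)) n
        (Function.update h n (h n - 1) n + 1) := by
      simp [Nat.sub_add_cancel (Nat.pos_of_ne_zero hn)]
    rw [h1]
    refine hs _ _ (ih _ ?_)
    have h2 := Finset.add_sum_erase Finset.univ h (Finset.mem_univ n)
    have h3 := Finset.add_sum_erase Finset.univ (Function.update h n (h n - 1))
      (Finset.mem_univ n)
    have h4 : ∑ k ∈ Finset.univ.erase n, Function.update h n (h n - 1) k =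
        ∑ k ∈ Finset.univ.erase n, h k := Finset.sum_congr rfl fun k hk => by
      rw [Function.update_of_ne (Finset.ne_of_mem_erase hk)]
    rw [h4, Function.update_self] at h3
    omega

/-! ### Sklyanin's covectors are eigencovectors of B -/

section Sklyanin

variable {N : ℕ} (ℓ : Fin N → ℕ) (η : ℂ) (ξ : Fin N → ℂ)
  (K : Matrix (Fin 2) (Fin 2) ℂ) (k₁ k₂ : ℂ)

/-- Sklyanin's covectors with labels in `ℕ`. -/
noncomputable def skLabel (h : Fin N → ℕ) : Covec ℓ :=
  (normConst ℓ η ξ)⁻¹ •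
    Matrix.vecMul (refCovec ℓ)
      (List.ofFn fun n : Fin N =>
        (List.ofFn fun k : Fin (h n) =>
          (k₁ * funA ℓ η ξ (node ℓ η ξ n k))⁻¹ • opA ℓ η ξ K (node ℓ η ξ n k)).prod).prod

theorem skCovec_eq_skLabel (h : Conf ℓ) :
    skCovec ℓ η ξ K k₁ h = skLabel ℓ η ξ K k₁ fun n => h n := rfl

theorem node_succ (n : Fin N) (k : ℕ) : node ℓ η ξ n (k + 1) = node ℓ η ξ n k - η := by
  simp only [node]
  push_cast
  ring

/-- The zeros of d are the first points of the strings, those of a the last ones. Hence a does not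
vanish where a label is raised, nor d where it is lowered. -/
theorem funD_eq (u : ℂ) : funD ℓ η ξ u = ∏ n, (u - node ℓ η ξ n 0) := by
  refine Finset.prod_congr rfl fun n _ => ?_
  simp only [node]
  push_cast
  ring

theorem funA_eq (u : ℂ) : funA ℓ η ξ u = ∏ n, (u - node ℓ η ξ n (ℓ n)) := by
  refine Finset.prod_congr rfl fun n _ => ?_
  simp only [node]
  ring

variable {η}

theorem skLabel_update (hη : η ≠ 0) (h : Fin N → ℕ) (n : Fin N) :
    skLabel ℓ η ξ K k₁ (Function.update h n (h n + 1)) =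
      (k₁ * funA ℓ η ξ (node ℓ η ξ n (h n)))⁻¹ •
        Matrix.vecMul (skLabel ℓ η ξ K k₁ h) (opA ℓ η ξ K (node ℓ η ξ n (h n))) := by
  have hA : ∀ u v, Commute (opA ℓ η ξ K u) (opA ℓ η ξ K v) :=
    (isRTT_monodromy ℓ η ξ K).commute_diag hη 0
  let g : Fin N → ℕ → Op ℓ := fun m k =>
    (k₁ * funA ℓ η ξ (node ℓ η ξ m k))⁻¹ • opA ℓ η ξ K (node ℓ η ξ m k)
  let f : Fin N → Op ℓ := fun m => (List.ofFn fun k : Fin (h m) => g m k).prod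
  have hg : ∀ m k m' k', Commute (g m k) (g m' k') := fun m k m' k' =>
    ((hA _ _).smul_left _).smul_right _
  have hf : ∀ m, Commute (f m) (g n (h n)) := by
    intro m
    refine Commute.list_prod_left _ _ fun y hy => ?_
    obtain ⟨k, rfl⟩ := (List.mem_ofFn' _ _).mp hy
    exact hg _ _ _ _
  have key : (fun m => (List.ofFn fun k : Fin (Function.update h n (h n + 1) m) => g m k).prod) =
      Function.update f n (f n * g n (h n)) := by
    funext m
    by_cases hm : m = n
    · subst hm
      rw [Function.update_self, Function.update_self, List.ofFn_succ', List.concat_eq_append,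
        List.prod_append, List.prod_singleton]
      rfl
    · rw [Function.update_of_ne hm, Function.update_of_ne hm]
  change (normConst ℓ η ξ)⁻¹ • Matrix.vecMul (refCovec ℓ) (List.ofFn fun m =>
    (List.ofFn fun k : Fin (Function.update h n (h n + 1) m) => g m k).prod).prod =
      _ • Matrix.vecMul ((normConst ℓ η ξ)⁻¹ • Matrix.vecMul (refCovec ℓ) (List.ofFn f).prod) _
  rw [key, prod_ofFn_update_mul f n _ hf, ← Matrix.vecMul_vecMul, Matrix.smul_vecMul,
    Matrix.vecMul_smul, smul_comm]

theorem continuous_opB_apply (x y : Conf ℓ) : Continuous fun u => opB ℓ η ξ K u x y := by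
  have hl : ∀ n i j, Continuous fun u => lax ℓ η n (u - ξ n) i j := by
    intro n i j
    refine continuous_matrix fun x y => ?_
    fin_cases i <;> fin_cases j <;>
    simp only [lax, Fin.zero_eta, Fin.mk_one, Fin.isValue, Matrix.of_apply, Matrix.cons_val',
      Matrix.cons_val_zero, Matrix.cons_val_one, Matrix.cons_val_fin_one, embedAt] <;>
    split_ifs <;>
    (try simp only [Matrix.add_apply, Matrix.sub_apply, Matrix.smul_apply, smul_eq_mul]) <;>
    fun_prop
  have hp : Continuous fun u => (List.ofFn fun n => lax ℓ η n (u - ξ n)).reverse.prod := by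
    simp_rw [List.ofFn_eq_map, ← List.map_reverse]
    exact continuous_list_prod _ fun n _ => continuous_matrix (hl n)
  have hm : Continuous fun u => monodromy ℓ η ξ K u := continuous_const.mul hp
  exact ((hm.matrix_elem 0 1).matrix_elem x y)

/-- The entry `A^{(K)}(ξ_n^{(h_n)})` maps an eigencovector of `B^{(K)}` with label `h` to one with
label `h + e_n`. -/
theorem eigencovector_opA (hη : η ≠ 0) {x : Covec ℓ} {h : Fin N → ℕ}
    (ih : ∀ w, Matrix.vecMul x (opB ℓ η ξ K w) =
      (K 0 1 * ∏ n, (w - node ℓ η ξ n (h n))) • x) (n : Fin N) (w : ℂ) :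
    Matrix.vecMul (Matrix.vecMul x (opA ℓ η ξ K (node ℓ η ξ n (h n)))) (opB ℓ η ξ K w) =
      (K 0 1 * ∏ m, (w - node ℓ η ξ m (Function.update h n (h n + 1) m))) •
        Matrix.vecMul x (opA ℓ η ξ K (node ℓ η ξ n (h n))) := by
  have hu : Matrix.vecMul x (opB ℓ η ξ K (node ℓ η ξ n (h n))) = 0 := by
    rw [ih, Finset.prod_eq_zero (Finset.mem_univ n) (sub_self _), mul_zero, zero_smul]
  set v := Matrix.vecMul x (opA ℓ η ξ K (node ℓ η ξ n (h n))) with hv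
  have hprod : ∀ (w : ℂ) (g : Fin N → ℕ), ∏ m, (w - node ℓ η ξ m (g m)) =
      (w - node ℓ η ξ n (g n)) * ∏ m ∈ Finset.univ.erase n, (w - node ℓ η ξ m (g m)) :=
    fun w g => (Finset.mul_prod_erase _ _ (Finset.mem_univ n)).symm
  have herase : ∀ w : ℂ, ∏ m ∈ Finset.univ.erase n,
      (w - node ℓ η ξ m (Function.update h n (h n + 1) m)) =
      ∏ m ∈ Finset.univ.erase n, (w - node ℓ η ξ m (h m)) := fun w =>
    Finset.prod_congr rfl fun m hm => by
      rw [Function.update_of_ne (Finset.ne_of_mem_erase hm)]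
  -- The exchange relation replaces the factor w - ξ_n^{(h_n)} of the eigenvalue by w - ξ_n^{(h_n)}
  -- + η = w - ξ_n^{(h_n+1)}, up to a common factor that is cancelled only for w ≠ ξ_n^{(h_n)}.
  have hne : ∀ w, w ≠ node ℓ η ξ n (h n) → Matrix.vecMul v (opB ℓ η ξ K w) =
      (K 0 1 * ∏ m, (w - node ℓ η ξ m (Function.update h n (h n + 1) m))) • v := by
    intro w hw
    have h1 := (isRTT_monodromy ℓ η ξ K).vecMul_A_vecMul_B hη hu (ih w)
    refine smul_right_injective _ (sub_ne_zero.mpr hw.symm) ?_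
    refine h1.trans ?_
    change _ = (node ℓ η ξ n (h n) - w) •
      ((K 0 1 * ∏ m, (w - node ℓ η ξ m (Function.update h n (h n + 1) m))) • v)
    rw [smul_smul, hprod w h, hprod w (Function.update h n (h n + 1)), herase,
      Function.update_self, node_succ]
    congr 1
    ring
  -- Both sides are continuous in w, which recovers the excluded point.
  refine congrFun (Continuous.ext_on (dense_compl_singleton (node ℓ η ξ n (h n)))
    ?_ ?_ fun w hw => hne w hw) w
  · refine continuous_pi fun y => ?_
    simp only [Matrix.vecMul, dotProduct]
    exact continuous_finsetSum _ fun x _ =>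
      continuous_const.mul (continuous_opB_apply ℓ ξ K x y)
  · fun_prop

/-- No bound on h is needed: where a vanishes, the inverse is 0 by convention and the covector is 0.
-/
theorem skLabel_opB (hη : η ≠ 0) (h : Fin N → ℕ) (w : ℂ) :
    Matrix.vecMul (skLabel ℓ η ξ K k₁ h) (opB ℓ η ξ K w) =
      (K 0 1 * ∏ n, (w - node ℓ η ξ n (h n))) • skLabel ℓ η ξ K k₁ h := by
  revert w
  refine multilabel_induction (P := fun h => ∀ w, Matrix.vecMul (skLabel ℓ η ξ K k₁ h)
    (opB ℓ η ξ K w) = (K 0 1 * ∏ n, (w - node ℓ η ξ n (h n))) • skLabel ℓ η ξ K k₁ h)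
    (fun w => ?_) (fun h n ih => ?_) h
  · have : skLabel ℓ η ξ K k₁ (fun _ => 0) = (normConst ℓ η ξ)⁻¹ • refCovec ℓ := by
      simp [skLabel]
    rw [this, Matrix.smul_vecMul, refCovec_opB, smul_comm, funD_eq]
  · intro w
    rw [skLabel_update ℓ ξ K k₁ hη, Matrix.smul_vecMul, eigencovector_opA ℓ ξ K hη ih,
      smul_comm]

end Sklyanin

/-! ### Raising, lowering and completeness of Sklyanin's covectors -/

section SklyaninBasis

variable {N : ℕ} {ℓ : Fin N → ℕ} {η : ℂ} {ξ : Fin N → ℂ}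
  {K : Matrix (Fin 2) (Fin 2) ℂ} {k₁ k₂ : ℂ}

theorem node_inj (hη : η ≠ 0) (n : Fin N) {j k : ℕ} (h : node ℓ η ξ n j = node ℓ η ξ n k) :
    j = k := by
  simp only [node, add_right_inj] at h
  have h1 := mul_right_cancel₀ hη h
  rw [sub_right_inj] at h1
  exact_mod_cast h1

theorem funA_node_ne_zero (hη : η ≠ 0) (hξ : StringsDisjoint ℓ η ξ) {n : Fin N} {k : ℕ}
    (hk : k < ℓ n) : funA ℓ η ξ (node ℓ η ξ n k) ≠ 0 := by
  rw [funA_eq]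
  refine Finset.prod_ne_zero_iff.mpr fun m _ => sub_ne_zero.mpr fun h => ?_
  by_cases hm : n = m
  · subst hm
    exact hk.ne (node_inj hη n h)
  · exact hξ n m hm k hk.le _ le_rfl h

theorem funD_node_ne_zero (hη : η ≠ 0) (hξ : StringsDisjoint ℓ η ξ) {n : Fin N} {k : ℕ}
    (hk : 0 < k) (hk' : k ≤ ℓ n) : funD ℓ η ξ (node ℓ η ξ n k) ≠ 0 := by
  rw [funD_eq]
  refine Finset.prod_ne_zero_iff.mpr fun m _ => sub_ne_zero.mpr fun h => ?_
  by_cases hm : n = m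
  · subst hm
    exact hk.ne' (node_inj hη n h)
  · exact hξ n m hm k hk' _ (Nat.zero_le _) h

theorem normConst_ne_zero (hξ : StringsDisjoint ℓ η ξ) : normConst ℓ η ξ ≠ 0 := by
  refine Finset.prod_ne_zero_iff.mpr fun a _ => Finset.prod_ne_zero_iff.mpr fun b hb => ?_
  rw [Ne, Complex.cpow_eq_zero_iff, not_and_or]
  exact Or.inl (sub_ne_zero.mpr
    (hξ a b (Finset.mem_Iio.mp hb).ne' 0 (Nat.zero_le _) 0 (Nat.zero_le _)))

theorem skLabel_vecMul_opA (hη : η ≠ 0) (hξ : StringsDisjoint ℓ η ξ) (hk₁ : k₁ ≠ 0)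
    (h : Fin N → ℕ) {n : Fin N} (hn : h n < ℓ n) :
    Matrix.vecMul (skLabel ℓ η ξ K k₁ h) (opA ℓ η ξ K (node ℓ η ξ n (h n))) =
      (k₁ * funA ℓ η ξ (node ℓ η ξ n (h n))) •
        skLabel ℓ η ξ K k₁ (Function.update h n (h n + 1)) := by
  rw [skLabel_update ℓ ξ K k₁ hη, smul_inv_smul₀ (mul_ne_zero hk₁ (funA_node_ne_zero hη hξ hn))]

theorem skLabel_opB_node (hη : η ≠ 0) (h : Fin N → ℕ) (n : Fin N) :
    Matrix.vecMul (skLabel ℓ η ξ K k₁ h) (opB ℓ η ξ K (node ℓ η ξ n (h n))) = 0 := by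
  rw [skLabel_opB ℓ ξ K k₁ hη, Finset.prod_eq_zero (Finset.mem_univ n) (sub_self _), mul_zero,
    zero_smul]

/-- The entry `D^{(K)}(ξ_n^{(h_n)})` lowers the label `h_n`. -/
theorem skLabel_vecMul_opD (hη : η ≠ 0) (hξ : StringsDisjoint ℓ η ξ) (hk₁ : k₁ ≠ 0)
    (hK : K.det = k₁ * k₂) (h : Fin N → ℕ) {n : Fin N} (hn : h n < ℓ n) :
    Matrix.vecMul (skLabel ℓ η ξ K k₁ (Function.update h n (h n + 1)))
        (monodromy ℓ η ξ K (node ℓ η ξ n (h n + 1)) 1 1) =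
      (k₂ * funD ℓ η ξ (node ℓ η ξ n (h n + 1))) • skLabel ℓ η ξ K k₁ h := by
  -- Since B vanishes here, A(ξ_n^{(h_n)}) D(ξ_n^{(h_n)} - η) acts as the quantum determinant k₁k₂
  -- a(ξ_n^{(h_n)}) d(ξ_n^{(h_n+1)}); dividing by the coefficient of the raising step leaves k₂ d.
  have h1 := (hasQDet_monodromy ℓ ξ hη K).vecMul_A_vecMul_D (skLabel_opB_node (k₁ := k₁) hη h n)
  have h2 := skLabel_vecMul_opA (K := K) hη hξ hk₁ h hn
  rw [opA] at h2
  rw [h2, Matrix.smul_vecMul, ← node_succ] at h1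
  have ha := mul_ne_zero hk₁ (funA_node_ne_zero hη hξ hn)
  refine smul_right_injective _ ha (h1.trans ?_)
  change _ = (k₁ * funA ℓ η ξ (node ℓ η ξ n (h n))) • _ • _
  rw [smul_smul, hK]
  congr 1
  ring

/-- If a covector vanished, then so would the one below it, because D lowers the label with a
nonzero coefficient; at the bottom stands a nonzero multiple of ⟨0|. -/
theorem skLabel_ne_zero (hη : η ≠ 0) (hξ : StringsDisjoint ℓ η ξ) (hk₁ : k₁ ≠ 0)
    (hk₂ : k₂ ≠ 0) (hK : K.det = k₁ * k₂) (h : Fin N → ℕ) (hh : ∀ n, h n ≤ ℓ n) :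
    skLabel ℓ η ξ K k₁ h ≠ 0 := by
  revert hh
  refine multilabel_induction (P := fun h => (∀ n, h n ≤ ℓ n) → skLabel ℓ η ξ K k₁ h ≠ 0)
    (fun _ h0 => ?_) (fun h n ih hh h0 => ?_) h
  · have : skLabel ℓ η ξ K k₁ (fun _ => 0) = (normConst ℓ η ξ)⁻¹ • refCovec ℓ := by
      simp [skLabel]
    rw [this] at h0
    have h1 := congrFun h0 fun _ => 0
    simp [refCovec, normConst_ne_zero hξ] at h1
  · have hn : h n < ℓ n := by simpa using hh n
    have hD := skLabel_vecMul_opD hη hξ hk₁ hK h hn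
    rw [h0, Matrix.zero_vecMul] at hD
    refine ih (fun m => ?_) ((smul_eq_zero.mp hD.symm).resolve_left
      (mul_ne_zero hk₂ (funD_node_ne_zero hη hξ (Nat.succ_pos _) hn)))
    by_cases hm : m = n
    · subst hm; exact hn.le
    · simpa [hm] using hh m

/-- The label h' is not bounded at n itself: below it also takes the forbidden value 2s_n + 1 there.
-/
theorem node_ne_of_label_ne (hη : η ≠ 0) (hξ : StringsDisjoint ℓ η ξ) {h h' : Fin N → ℕ}
    {n : Fin N} (hn : h n ≤ ℓ n) (hh' : ∀ m, m ≠ n → h' m ≤ ℓ m) (hne : h n ≠ h' n)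
    (m : Fin N) : node ℓ η ξ n (h n) ≠ node ℓ η ξ m (h' m) := by
  by_cases hm : n = m
  · subst hm
    exact fun e => hne (node_inj hη n e)
  · exact hξ n m hm _ hn _ (hh' m (Ne.symm hm))

theorem isCovectorBasis_of_linearIndependent {v : Conf ℓ → Covec ℓ}
    (hv : LinearIndependent ℂ v) : IsCovectorBasis v :=
  ⟨hv, hv.span_eq_top_of_card_eq_finrank' (by simp)⟩

theorem isCovectorBasis_skCovec (hη : η ≠ 0) (hξ : StringsDisjoint ℓ η ξ) (hk₁ : k₁ ≠ 0)
    (hk₂ : k₂ ≠ 0) (hK : K.det = k₁ * k₂) (hb : K 0 1 ≠ 0) :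
    IsCovectorBasis (skCovec ℓ η ξ K k₁) := by
  refine isCovectorBasis_of_linearIndependent (linearIndependent_of_joint_eigenvectors
    (fun w : ℂ => (opB ℓ η ξ K w).vecMulLinear) _
    (fun w h => K 0 1 * ∏ n, (w - node ℓ η ξ n (h n))) (fun w h => skLabel_opB ℓ ξ K k₁ hη _ w)
    (fun h h' hne => ?_)
    fun h => skLabel_ne_zero hη hξ hk₁ hk₂ hK _ fun n => Nat.lt_succ_iff.mp (h n).2)
  obtain ⟨n, hn⟩ := Function.ne_iff.mp hne
  -- At this point the eigenvalue labelled h vanishes and the one labelled h' does not.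
  refine ⟨node ℓ η ξ n (h n), ?_⟩
  rw [Finset.prod_eq_zero (Finset.mem_univ n) (sub_self _), mul_zero]
  refine (mul_ne_zero hb (Finset.prod_ne_zero_iff.mpr fun m _ => sub_ne_zero.mpr ?_)).symm
  exact node_ne_of_label_ne (h := fun n => h n) (h' := fun n => h' n) hη hξ
    (Nat.lt_succ_iff.mp (h n).2) (fun m _ => Nat.lt_succ_iff.mp (h' m).2)
    (fun e => hn (Fin.ext e)) m

/-- The entry `A^{(K)}(ξ_n^{(2 s_n)})` annihilates the covectors with `h_n = 2 s_n`. -/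
theorem skLabel_vecMul_opA_last (hη : η ≠ 0) (hξ : StringsDisjoint ℓ η ξ) (hk₁ : k₁ ≠ 0)
    (hk₂ : k₂ ≠ 0) (hK : K.det = k₁ * k₂) (hb : K 0 1 ≠ 0) (h : Fin N → ℕ)
    (hh : ∀ n, h n ≤ ℓ n) {n : Fin N} (hn : h n = ℓ n) :
    Matrix.vecMul (skLabel ℓ η ξ K k₁ h) (opA ℓ η ξ K (node ℓ η ξ n (ℓ n))) = 0 := by
  obtain ⟨hli, hspan⟩ := isCovectorBasis_skCovec hη hξ hk₁ hk₂ hK hb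
  have hB := eigencovector_opA ℓ ξ K hη (skLabel_opB ℓ ξ K k₁ hη h) n
  rw [hn] at hB
  set v := Matrix.vecMul (skLabel ℓ η ξ K k₁ h) (opA ℓ η ξ K (node ℓ η ξ n (ℓ n))) with hv
  obtain ⟨c, hc⟩ := (Submodule.mem_span_range_iff_exists_fun ℂ).mp
    (hspan ▸ Submodule.mem_top : v ∈ Submodule.span ℂ (Set.range (skCovec ℓ η ξ K k₁)))
  -- The covector v satisfies the B-eigenvalue equation with label 2s_n + 1 at n. Expanding v in the
  -- basis compares this eigenvalue with those labelled g; at w = ξ_n^{(g_n)} the latter vanishes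
  -- and the former does not, so each coefficient of v is zero.
  have key : ∀ w, ∑ g : Conf ℓ, (c g * (K 0 1 * ∏ m, (w - node ℓ η ξ m (g m)) -
      K 0 1 * ∏ m, (w - node ℓ η ξ m (Function.update h n (ℓ n + 1) m)))) •
        skCovec ℓ η ξ K k₁ g = 0 := by
    intro w
    have h1 := hB w
    rw [← hc, Matrix.sum_vecMul, Finset.smul_sum, ← sub_eq_zero, ← Finset.sum_sub_distrib] at h1
    rw [← h1]
    refine Finset.sum_congr rfl fun g _ => ?_
    have h2 := skLabel_opB ℓ ξ K k₁ hη (fun n => (g n : ℕ)) w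
    rw [← skCovec_eq_skLabel] at h2
    rw [Matrix.smul_vecMul, h2]
    module
  rw [← hc]
  refine Finset.sum_eq_zero fun g _ => ?_
  have h3 := linearIndependent_iff'.mp hli _ _ (key (node ℓ η ξ n (g n))) g (Finset.mem_univ g)
  rw [Finset.prod_eq_zero (Finset.mem_univ n) (sub_self _), mul_zero, zero_sub] at h3
  rw [(mul_eq_zero.mp h3).resolve_right, zero_smul]
  refine neg_ne_zero.mpr (mul_ne_zero hb (Finset.prod_ne_zero_iff.mpr fun m _ =>
    sub_ne_zero.mpr ?_))
  refine node_ne_of_label_ne (h := fun n => g n) hη hξ (Nat.lt_succ_iff.mp (g n).2)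
    (fun m hm => ?_) ?_ m
  · rw [Function.update_of_ne hm]
    exact hh m
  · rw [Function.update_self]
    exact (g n).2.ne

end SklyaninBasis

end SoV

open Polynomial in
theorem Polynomial.coeff_X_mul_derivative {R : Type*} [Semiring R] (f : R[X]) (k : ℕ) :
    (X * derivative f).coeff k = f.coeff k * k := by
  cases k with
  | zero => simp
  | succ k => rw [coeff_X_mul, coeff_derivative]; push_cast; rfl

namespace SoV

/-! ### Words in two letters and the symmetrizer -/

section Words

variable {m : ℕ}

/-- The number of letters `1` in a word. -/
def ones (x : Fin m → Fin 2) : ℕ := (Finset.univ.filter fun k => x k = 1).card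

theorem ones_comp (x : Fin m → Fin 2) (π : Equiv.Perm (Fin m)) : ones (x ∘ π) = ones x := by
  refine Finset.card_bij (fun k _ => π k) (by simp) (by simp) fun k hk => ⟨π.symm k, ?_⟩
  simpa using hk

theorem exists_perm_of_ones_eq {x y : Fin m → Fin 2} (h : ones x = ones y) :
    ∃ π : Equiv.Perm (Fin m), x = y ∘ π := by
  have e : { k // x k = 1 } ≃ { k // y k = 1 } := Fintype.equivOfCardEq (by
    rw [Fintype.card_subtype, Fintype.card_subtype]; exact h)
  refine ⟨e.extendSubtype, funext fun k => ?_⟩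
  by_cases hk : x k = 1
  · rw [hk]
    exact (e.extendSubtype_mem k hk).symm
  · have := e.extendSubtype_not_mem k hk
    simp only [Function.comp]
    omega

theorem ones_eq_iff (x : Fin m → Fin 2) : ones x = m ↔ x = fun _ => 1 := by
  have h := Finset.card_filter_eq_iff (s := Finset.univ) (p := fun k => x k = 1)
  rw [Finset.card_univ, Fintype.card_fin] at h
  rw [ones, h, funext_iff]
  simp

theorem ones_cons (i : Fin 2) (x : Fin m → Fin 2) :
    ones (Fin.cons i x : Fin (m + 1) → Fin 2) = ones x + if i = 1 then 1 else 0 := by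
  simp only [ones, Finset.card_filter, Fin.sum_univ_succ, Fin.cons_zero, Fin.cons_succ]
  rw [add_comm]

/-- The sum over permutations depends only on `ones z`. Summed over the words with this count, it
gives m! times the sum of F over them, which is 0. -/
theorem sum_perm_eq_zero {V : Type*} [AddCommGroup V] [Module ℂ V] (F : (Fin m → Fin 2) → V)
    (z : Fin m → Fin 2) (hF : ∑ x with ones x = ones z, F x = 0) :
    ∑ π : Equiv.Perm (Fin m), F (z ∘ π) = 0 := by
  have h1 : ∀ z', ones z' = ones z → ∑ π : Equiv.Perm (Fin m), F (z' ∘ π) =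
      ∑ π : Equiv.Perm (Fin m), F (z ∘ π) := by
    intro z' hz
    obtain ⟨σ, rfl⟩ := exists_perm_of_ones_eq hz
    exact Fintype.sum_equiv (Equiv.mulLeft σ) _ _ fun π => rfl
  have h2 : ∑ z' with ones z' = ones z, ∑ π : Equiv.Perm (Fin m), F (z' ∘ π) = 0 := by
    rw [Finset.sum_comm]
    refine Finset.sum_eq_zero fun π _ => ?_
    rw [← hF]
    refine Finset.sum_bij (fun x _ => x ∘ π) (fun x hx => ?_) (fun x _ y _ h => ?_)
      (fun x hx => ⟨x ∘ π.symm, ?_, ?_⟩) fun x _ => rfl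
    · simpa [ones_comp] using hx
    · exact π.surjective.injective_comp_right h
    · simpa [ones_comp] using hx
    · funext k; simp
  rw [Finset.sum_congr rfl fun z' hz => h1 z' (Finset.mem_filter.mp hz).2, Finset.sum_const,
    ← Nat.cast_smul_eq_nsmul ℂ, smul_eq_zero] at h2
  refine h2.resolve_left ?_
  rw [Nat.cast_eq_zero, Finset.card_eq_zero, ← Ne, ← Finset.nonempty_iff_ne_empty]
  exact ⟨z, by simp⟩

theorem symProj_mul_apply {R : Type*} [Ring R] [Algebra ℂ R]
    (X : Matrix (Fin m → Fin 2) (Fin m → Fin 2) R) (z y : Fin m → Fin 2) :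
    ((symProj m).map (algebraMap ℂ R) * X) z y =
      (m.factorial : ℂ)⁻¹ • ∑ π : Equiv.Perm (Fin m), X (z ∘ π) y := by
  simp only [Matrix.mul_apply, Matrix.map_apply, ← Algebra.smul_def, symProj, Matrix.smul_apply,
    Matrix.sum_apply, smul_assoc, Finset.sum_smul, permOp, Matrix.of_apply, ite_smul, one_smul,
    zero_smul]
  rw [← Finset.smul_sum, Finset.sum_comm]
  congr 1
  refine Fintype.sum_equiv (Equiv.inv _) _ _ fun π => ?_
  rw [Finset.sum_eq_single (z ∘ π.symm)]
  · rw [if_pos (by funext k; simp)]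
    rfl
  · intro x _ hx
    rw [if_neg]
    rintro rfl
    exact hx (by funext k; simp)
  · simp

theorem symProj_apply_ones (y : Fin m → Fin 2) :
    symProj m y (fun _ => 1) = if y = (fun _ => 1) then 1 else 0 := by
  simp only [symProj, Matrix.smul_apply, Matrix.sum_apply, permOp, Matrix.of_apply,
    show ∀ π : Equiv.Perm (Fin m), (fun _ : Fin m => (1 : Fin 2)) ∘ π =
      fun _ => 1 from fun _ => rfl, Finset.sum_const, Finset.card_univ, Fintype.card_perm,
    Fintype.card_fin, smul_eq_mul, nsmul_eq_mul]
  split_ifs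
  · rw [mul_one, inv_mul_cancel₀ (Nat.cast_ne_zero.mpr m.factorial_ne_zero)]
  · simp

end Words

open Polynomial

/-! ### Generating polynomials of row words -/

section RowPoly

variable {R : Type*} [Ring R]

/-- The product of the entries `(x k, y k)` of the matrices `M (w + (m - 1 - k) η)`. -/
noncomputable def entryProd (η : ℂ) (M : ℂ → Matrix (Fin 2) (Fin 2) R) (w : ℂ) {m : ℕ}
    (x y : Fin m → Fin 2) : R :=
  (List.ofFn fun k : Fin m => M (w + ((m : ℂ) - 1 - (k : ℕ)) * η) (x k) (y k)).prod

/-- The generating polynomial of the products `entryProd` over the row words. -/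
noncomputable def rowPoly (η : ℂ) (M : ℂ → Matrix (Fin 2) (Fin 2) R) (w : ℂ) {m : ℕ}
    (y : Fin m → Fin 2) : R[X] :=
  ∑ x, monomial (ones x) (entryProd η M w x y)

theorem coeff_rowPoly (η : ℂ) (M : ℂ → Matrix (Fin 2) (Fin 2) R) (w : ℂ) {m : ℕ}
    (y : Fin m → Fin 2) (k : ℕ) :
    (rowPoly η M w y).coeff k = ∑ x with ones x = k, entryProd η M w x y := by
  simp only [rowPoly, finsetSum_coeff, coeff_monomial, Finset.sum_filter]

theorem entryProd_succ (η : ℂ) (M : ℂ → Matrix (Fin 2) (Fin 2) R) (w : ℂ) {m : ℕ}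
    (x y : Fin (m + 1) → Fin 2) : entryProd η M w x y =
      M (w + m * η) (x 0) (y 0) * entryProd η M w (Fin.tail x) (Fin.tail y) := by
  simp only [entryProd, List.ofFn_succ, List.prod_cons, Fin.val_zero, Fin.val_succ, Fin.tail]
  push_cast
  simp only [add_sub_cancel_right, sub_zero]
  congr 3
  funext k
  congr 2
  ring

/-- The letters are summed independently, so the generating polynomial is an ordered product of
linear factors. The new factor stands on the left, and w remains the parameter of the last one. -/
theorem rowPoly_succ (η : ℂ) (M : ℂ → Matrix (Fin 2) (Fin 2) R) (w : ℂ) {m : ℕ}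
    (y : Fin (m + 1) → Fin 2) : rowPoly η M w y =
      (C (M (w + m * η) 0 (y 0)) + X * C (M (w + m * η) 1 (y 0))) *
        rowPoly η M w (Fin.tail y) := by
  rw [rowPoly, ← Fintype.sum_equiv (Fin.consEquiv fun _ : Fin (m + 1) => Fin 2) _ _ fun x => rfl,
    Fintype.sum_prod_type, Fin.sum_univ_two, add_mul, rowPoly, Finset.mul_sum, Finset.mul_sum]
  congr 1 <;> refine Finset.sum_congr rfl fun x _ => ?_
  · simp [Fin.consEquiv, ones_cons, entryProd_succ, C_mul_monomial]
  · simp [Fin.consEquiv, ones_cons, entryProd_succ, C_mul_monomial, mul_assoc, X_mul_monomial]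

theorem rowPoly_zero (η : ℂ) (M : ℂ → Matrix (Fin 2) (Fin 2) R) (w : ℂ) (y : Fin 0 → Fin 2) :
    rowPoly η M w y = 1 := by
  simp [rowPoly, entryProd, ones]

end RowPoly

/-! ### Fusion: moving the last row to the front -/

section Fusion

variable {R : Type*} [Ring R] [Algebra ℂ R]

/-- Products `f` of `n` symmetrized rows whose polarization factors through the rows of `M w`
keep this property when one more row is put in front. -/
theorem IsRTT.exists_move_left {η : ℂ} (hη : η ≠ 0) {M : ℂ → Matrix (Fin 2) (Fin 2) R}
    (hM : IsRTT η M) {x : R} (hx : ∀ y, Commute x y) {u w : ℂ} {n : ℕ} (hn : n ≠ 0)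
    (huw : u - w = n * η) (j : Fin 2) (f : R) (g : Fin 2 → R)
    (hf : (n : ℂ) • f = ∑ p, M w 0 p * g p + x * ∑ p, M w 1 p * g p) :
    ∃ g' : Fin 2 → R, ∀ i, M u i j * f + (M u 0 j + x * M u 1 j) * ∑ p, M w i p * g p =
      ∑ p, M w i p * g' p := by
  have hn' : (n : ℂ) ≠ 0 := Nat.cast_ne_zero.mpr hn
  have rel : ∀ i j k l, (n : ℂ) • (M u i j * M w k l) + M u k j * M w i l =
      (n : ℂ) • (M w k l * M u i j) + M w k j * M u i l := by
    intro i j k l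
    have h := hM u w i j k l
    rw [huw, mul_comm, mul_smul, mul_smul, ← smul_add, ← smul_add] at h
    exact smul_right_injective R hη h
  -- After multiplication by n, the relation with u - w = nη produces two kinds of terms. The first
  -- have M w i p in front of the new row; the second always have M w i j in front, whatever p is,
  -- and are collected in the component p = j.
  refine ⟨fun p => (M u 0 j + x * M u 1 j) * g p +
    if p = j then (n : ℂ)⁻¹ • ∑ q, (M u 0 q + x * M u 1 q) * g q else 0, fun i => ?_⟩
  refine smul_right_injective R hn' ?_
  have e1 : (n : ℂ) • (M u i j * f + (M u 0 j + x * M u 1 j) * ∑ p, M w i p * g p) =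
      ∑ p, (((n : ℂ) • (M u 0 j * M w i p) + M u i j * M w 0 p) +
        x * ((n : ℂ) • (M u 1 j * M w i p) + M u i j * M w 1 p)) * g p := by
    rw [smul_add, ← mul_smul_comm, hf]
    simp only [Finset.mul_sum, mul_add, add_mul, Finset.sum_add_distrib,
      mul_smul_comm, smul_mul_assoc, mul_assoc, (hx _).left_comm, smul_add, Finset.smul_sum]
    abel
  have e2 : (n : ℂ) • ∑ p, M w i p * ((M u 0 j + x * M u 1 j) * g p +
      if p = j then (n : ℂ)⁻¹ • ∑ q, (M u 0 q + x * M u 1 q) * g q else 0) =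
      ∑ p, (((n : ℂ) • (M w i p * M u 0 j) + M w i j * M u 0 p) +
        x * ((n : ℂ) • (M w i p * M u 1 j) + M w i j * M u 1 p)) * g p := by
    simp only [mul_add, Finset.sum_add_distrib, mul_ite, mul_zero, Finset.sum_ite_eq',
      Finset.mem_univ, if_true, smul_add, mul_smul_comm, smul_inv_smul₀ hn']
    simp only [Finset.mul_sum, mul_add, add_mul, Finset.sum_add_distrib, smul_mul_assoc, mul_assoc, (hx _).left_comm, smul_add, Finset.smul_sum]
    abel
  refine e1.trans (Eq.trans ?_ e2.symm)
  simp_rw [rel]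

/-- The two left-hand sides are the partial derivatives of the homogenized generating polynomial F,
of degree m + 1, at (1, X). Both factor through the rows of M(w) with the same cofactors g. Euler's
identity recovers (m + 1)F from them, which is the hypothesis of `IsRTT.exists_move_left`, and the
product rule gives the induction step. -/
theorem IsRTT.exists_rowPoly {η : ℂ} (hη : η ≠ 0) {M : ℂ → Matrix (Fin 2) (Fin 2) R}
    (hM : IsRTT η M) (w : ℂ) {m : ℕ} (y : Fin (m + 1) → Fin 2) :
    ∃ g : Fin 2 → R[X],
      (m + 1 : ℂ) • rowPoly η M w y - X * derivative (rowPoly η M w y) =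
        ∑ p, C (M w 0 p) * g p ∧
      derivative (rowPoly η M w y) = ∑ p, C (M w 1 p) * g p := by
  induction m with
  | zero =>
    refine ⟨fun p => if p = y 0 then 1 else 0, ?_⟩
    rw [rowPoly_succ, rowPoly_zero]
    simp
  | succ m ih =>
    obtain ⟨g, hg0, hg1⟩ := ih (Fin.tail y)
    have hM' : IsRTT η fun u => (M u).map (CAlgHom (R := ℂ) (A := R)) := hM.map _
    obtain ⟨g', hg'⟩ := hM'.exists_move_left hη (x := X) (fun p => commute_X p)
      (u := w + ((m + 1 : ℕ) : ℂ) * η) (w := w) (n := m + 1) (Nat.succ_ne_zero m)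
      (by ring) (y 0) (rowPoly η M w (Fin.tail y)) g (by
        simp only [Matrix.map_apply, CAlgHom_apply, ← hg0, ← hg1]
        push_cast
        rw [sub_add_cancel])
    refine ⟨g', ?_, ?_⟩
    · have h := hg' 0
      simp only [Matrix.map_apply, CAlgHom_apply, ← hg0] at h
      have hX : ∀ p q : R[X], p * (X * q) = X * (p * q) := fun p q =>
        (commute_X p).symm.left_comm q
      have hd : ∀ a b : R, derivative (C a + X * C b) = C b := fun a b => by simp
      rw [← h, rowPoly_succ, derivative_mul, hd]
      simp only [add_mul, mul_add, mul_sub, mul_assoc, mul_smul_comm, hX]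
      push_cast
      module
    · have h := hg' 1
      simp only [Matrix.map_apply, CAlgHom_apply, ← hg1] at h
      rw [← h, rowPoly_succ, derivative_mul]
      simp

variable {n : Type*} [Fintype n] [DecidableEq n]

/-- By the factorization v kills mF - XF', whose k-th coefficient is (m - k) times that of F. -/
theorem vecMul_rowPoly_coeff {η : ℂ} (hη : η ≠ 0) {M : ℂ → Matrix (Fin 2) (Fin 2) (Matrix n n ℂ)}
    (hM : IsRTT η M) {w : ℂ} {v : n → ℂ} (hv : ∀ p, Matrix.vecMul v (M w 0 p) = 0) {m : ℕ}
    (y : Fin m → Fin 2) {k : ℕ} (hk : k < m) :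
    Matrix.vecMul v ((rowPoly η M w y).coeff k) = 0 := by
  obtain ⟨m, rfl⟩ := Nat.exists_eq_succ_of_ne_zero (Nat.ne_zero_of_lt hk)
  obtain ⟨g, hg, -⟩ := hM.exists_rowPoly hη w y
  have h := congrArg (fun f => Matrix.vecMul v (f.coeff k)) hg
  simp only [coeff_sub, coeff_smul, coeff_X_mul_derivative, finsetSum_coeff, coeff_C_mul,
    Matrix.vecMul_sum, ← Matrix.vecMul_vecMul, hv, Matrix.zero_vecMul, Finset.sum_const_zero] at h
  rw [← (Nat.cast_commute k _).eq, ← nsmul_eq_mul, ← Nat.cast_smul_eq_nsmul ℂ, ← sub_smul,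
    Matrix.vecMul_smul] at h
  refine (smul_eq_zero.mp h).resolve_left (sub_ne_zero.mpr ?_)
  exact_mod_cast hk.ne'

/-- Symmetrizing a row word averages over the words with as many letters 1, which is a multiple of a
coefficient of the row polynomial. Hence v kills every row of P⁺X but the one of the word 1⋯1, which
P⁺ fixes. -/
theorem vecMul_fused_trace {η : ℂ} (hη : η ≠ 0)
    {M : ℂ → Matrix (Fin 2) (Fin 2) (Matrix n n ℂ)} (hM : IsRTT η M) {w : ℂ} {v : n → ℂ}
    (hv : ∀ p, Matrix.vecMul v (M w 0 p) = 0) {m : ℕ}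
    {X : Matrix (Fin m → Fin 2) (Fin m → Fin 2) (Matrix n n ℂ)}
    (hX : ∀ x y, X x y = entryProd η M w x y) :
    Matrix.vecMul v ((symProj m).map (algebraMap ℂ (Matrix n n ℂ)) * X *
      (symProj m).map (algebraMap ℂ (Matrix n n ℂ))).trace =
      Matrix.vecMul v (entryProd η M w (fun _ : Fin m => 1) fun _ => 1) := by
  have h1 : ∀ z y, z ≠ (fun _ => 1) → Matrix.vecMul v
      (((symProj m).map (algebraMap ℂ (Matrix n n ℂ)) * X) z y) = 0 := by
    intro z y hz
    rw [symProj_mul_apply, Matrix.vecMul_smul, Matrix.vecMul_sum,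
      sum_perm_eq_zero (fun x => Matrix.vecMul v (X x y)) z, smul_zero]
    simp only [hX]
    rw [← Matrix.vecMul_sum, ← coeff_rowPoly]
    refine vecMul_rowPoly_coeff hη hM hv y (lt_of_le_of_ne ?_ (mt (ones_eq_iff z).mp hz))
    exact (Finset.card_filter_le _ _).trans (by simp)
  have h2 : ((symProj m).map (algebraMap ℂ (Matrix n n ℂ)) * X) (fun _ => 1) (fun _ => 1) =
      entryProd η M w (fun _ : Fin m => 1) fun _ => 1 := by
    rw [symProj_mul_apply]
    simp only [show ∀ π : Equiv.Perm (Fin m), (fun _ : Fin m => (1 : Fin 2)) ∘ π = fun _ => 1 from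
      fun _ => rfl, Finset.sum_const, Finset.card_univ, Fintype.card_perm, Fintype.card_fin, hX]
    rw [← Nat.cast_smul_eq_nsmul ℂ, inv_smul_smul₀ (Nat.cast_ne_zero.mpr m.factorial_ne_zero)]
  rw [Matrix.trace, Matrix.vecMul_sum, Finset.sum_eq_single fun _ => 1]
  · rw [Matrix.diag_apply, Matrix.mul_apply, Finset.sum_eq_single fun _ => 1]
    · rw [Matrix.map_apply, symProj_apply_ones, if_pos rfl, map_one, mul_one, h2]
    · intro y _ hy
      rw [Matrix.map_apply, symProj_apply_ones, if_neg hy, map_zero, mul_zero]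
    · simp
  · intro z _ hz
    rw [Matrix.diag_apply, Matrix.mul_apply, Matrix.vecMul_sum]
    refine Finset.sum_eq_zero fun y _ => ?_
    rw [← Matrix.vecMul_vecMul, h1 z y hz, Matrix.zero_vecMul]
  · simp

end Fusion

/-! ### The transfer-matrix covectors agree with Sklyanin's -/

section SeparateVariables

variable {N : ℕ} {ℓ : Fin N → ℕ} {η : ℂ} {ξ : Fin N → ℂ}
  {K : Matrix (Fin 2) (Fin 2) ℂ} {k₁ k₂ : ℂ}

theorem embedAt_ofFn_prod_apply {R : Type} [Ring R] {m : ℕ}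
    (X : Fin m → Matrix (Fin 2) (Fin 2) R) (x y : Fin m → Fin 2) :
    (List.ofFn fun k : Fin m => embedAt (κ := fun _ : Fin m => Fin 2) k (X k)).prod x y =
      (List.ofFn fun k : Fin m => X k (x k) (y k)).prod := by
  rw [List.ofFn_eq_map, List.ofFn_eq_map,
    embedAt_prod_apply (κ := fun _ : Fin m => Fin 2) X _ (List.nodup_finRange m), if_pos]
  intro k hk
  exact absurd (List.mem_finRange k) hk

theorem node_add (n : Fin N) {m : ℕ} (hm : m ≤ ℓ n) :
    node ℓ η ξ n (ℓ n) + m * η = node ℓ η ξ n (ℓ n - m) := by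
  simp only [node, Nat.cast_sub hm]
  ring

theorem skLabel_entryProd (hη : η ≠ 0) (hξ : StringsDisjoint ℓ η ξ) (hk₁ : k₁ ≠ 0)
    (hK : K.det = k₁ * k₂) (h : Fin N → ℕ) {n : Fin N} (hn : h n = ℓ n) {m : ℕ}
    (hm : m ≤ ℓ n) :
    Matrix.vecMul (skLabel ℓ η ξ K k₁ h)
      (entryProd η (monodromy ℓ η ξ K) (node ℓ η ξ n (ℓ n)) (fun _ : Fin m => 1) fun _ => 1) =
      (k₂ ^ m * ∏ k ∈ Finset.range m, funD ℓ η ξ (node ℓ η ξ n (ℓ n - k))) •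
        skLabel ℓ η ξ K k₁ (Function.update h n (ℓ n - m)) := by
  induction m with
  | zero =>
    rw [Nat.sub_zero, ← hn, Function.update_eq_self]
    simp [entryProd]
  | succ m ih =>
    -- The product puts D(ξ_n^{(2s_n-m)}) first, but lowering from 2s_n must use it last; the D's
    -- commute.
    have hc : Commute (monodromy ℓ η ξ K (node ℓ η ξ n (ℓ n) + m * η) 1 1)
        (entryProd η (monodromy ℓ η ξ K) (node ℓ η ξ n (ℓ n)) (fun _ : Fin m => 1)
          fun _ => 1) := by
      refine Commute.list_prod_right _ _ fun y hy => ?_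
      obtain ⟨k, rfl⟩ := (List.mem_ofFn' _ _).mp hy
      exact (isRTT_monodromy ℓ η ξ K).commute_diag hη 1 _ _
    have e : ℓ n - m = ℓ n - (m + 1) + 1 := by omega
    have hD := skLabel_vecMul_opD hη hξ hk₁ hK (Function.update h n (ℓ n - (m + 1))) (n := n)
      (by rw [Function.update_self]; omega)
    rw [Function.update_self, Function.update_idem, ← e] at hD
    rw [entryProd_succ]
    change Matrix.vecMul _ (monodromy ℓ η ξ K (node ℓ η ξ n (ℓ n) + m * η) 1 1 *
      entryProd η (monodromy ℓ η ξ K) (node ℓ η ξ n (ℓ n)) (fun _ : Fin m => 1) fun _ => 1) = _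
    rw [hc.eq, ← Matrix.vecMul_vecMul, ih (by omega), Matrix.smul_vecMul,
      node_add n (by omega), hD, smul_smul, Finset.prod_range_succ]
    congr 1
    ring

theorem skLabel_fusedTransfer (hη : η ≠ 0) (hξ : StringsDisjoint ℓ η ξ) (hk₁ : k₁ ≠ 0)
    (hk₂ : k₂ ≠ 0) (hK : K.det = k₁ * k₂) (hb : K 0 1 ≠ 0) (h : Fin N → ℕ)
    (hh : ∀ n, h n ≤ ℓ n) {n : Fin N} (hn : h n = ℓ n) {m : ℕ} (hm : m ≤ ℓ n) :
    Matrix.vecMul (skLabel ℓ η ξ K k₁ h) (fusedTransfer ℓ η ξ K m (node ℓ η ξ n (ℓ n))) =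
      (k₂ ^ m * ∏ k ∈ Finset.range m, funD ℓ η ξ (node ℓ η ξ n (ℓ n - k))) •
        skLabel ℓ η ξ K k₁ (Function.update h n (ℓ n - m)) := by
  rw [← skLabel_entryProd hη hξ hk₁ hK h hn hm, fusedTransfer, fusedMonodromy]
  refine vecMul_fused_trace hη (isRTT_monodromy ℓ η ξ K) (fun p => ?_)
    fun x y => embedAt_ofFn_prod_apply _ x y
  fin_cases p
  · exact skLabel_vecMul_opA_last hη hξ hk₁ hk₂ hK hb h hh hn
  · exact hn ▸ skLabel_opB_node hη h n

theorem sovCovec_skCovec (hη : η ≠ 0) (hξ : StringsDisjoint ℓ η ξ) (hk₁ : k₁ ≠ 0)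
    (hk₂ : k₂ ≠ 0) (hK : K.det = k₁ * k₂) (hb : K 0 1 ≠ 0) (h : Conf ℓ) :
    sovCovec ℓ η ξ K k₂ (skCovec ℓ η ξ K k₁ (topConf ℓ)) h = skCovec ℓ η ξ K k₁ h := by
  let O : Fin N → Op ℓ := fun n => (k₂ ^ (((h n : ℕ) : ℤ) - (ℓ n : ℤ)) /
    ∏ k ∈ Finset.range (ℓ n - (h n : ℕ)), funD ℓ η ξ (node ℓ η ξ n (ℓ n - k))) •
      fusedTransfer ℓ η ξ K (ℓ n - (h n : ℕ)) (node ℓ η ξ n (ℓ n))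
  have hle : ∀ n, (h n : ℕ) ≤ ℓ n := fun n => Nat.lt_succ_iff.mp (h n).2
  -- A normalized factor only changes the label at its own site from 2s_n to h_n, so the sites can
  -- be treated one after the other.
  have step : ∀ (g : Fin N → ℕ) (n : Fin N), (∀ n, g n ≤ ℓ n) → g n = ℓ n →
      Matrix.vecMul (skLabel ℓ η ξ K k₁ g) (O n) =
        skLabel ℓ η ξ K k₁ (Function.update g n (h n)) := by
    intro g n hg hn
    rw [Matrix.vecMul_smul, skLabel_fusedTransfer hη hξ hk₁ hk₂ hK hb g hg hn (Nat.sub_le _ _),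
      Nat.sub_sub_self (hle n), smul_smul]
    have hd : ∏ k ∈ Finset.range (ℓ n - (h n : ℕ)), funD ℓ η ξ (node ℓ η ξ n (ℓ n - k)) ≠ 0 :=
      Finset.prod_ne_zero_iff.mpr fun k hk => funD_node_ne_zero hη hξ
        (by have := Finset.mem_range.mp hk; omega) (Nat.sub_le _ _)
    have hz : k₂ ^ (((h n : ℕ) : ℤ) - (ℓ n : ℤ)) = (k₂ ^ (ℓ n - (h n : ℕ)))⁻¹ := by
      rw [← zpow_natCast, ← zpow_neg, Nat.cast_sub (hle n), neg_sub]
    rw [hz, div_mul_eq_mul_div, ← mul_assoc, inv_mul_cancel₀ (pow_ne_zero _ hk₂), one_mul,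
      div_self hd, one_smul]
  have main : ∀ (l : List (Fin N)) (g : Fin N → ℕ), l.Nodup → (∀ n, g n ≤ ℓ n) →
      (∀ n ∈ l, g n = ℓ n) → Matrix.vecMul (skLabel ℓ η ξ K k₁ g) (l.map O).prod =
        skLabel ℓ η ξ K k₁ fun n => if n ∈ l then (h n : ℕ) else g n := by
    intro l
    induction l with
    | nil => intro g _ _ _; simp
    | cons a l ih =>
      intro g hl hg hgl
      rw [List.nodup_cons] at hl
      rw [List.map_cons, List.prod_cons, ← Matrix.vecMul_vecMul,
        step g a hg (hgl a List.mem_cons_self), ih _ hl.2]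
      · congr 1
        funext n
        by_cases hn : n = a
        · subst hn; simp [hl.1]
        · simp [hn]
      · intro n
        by_cases hn : n = a
        · subst hn; simpa using hle n
        · simpa [hn] using hg n
      · intro n hn
        rw [Function.update_of_ne (by rintro rfl; exact hl.1 hn)]
        exact hgl n (List.mem_cons_of_mem a hn)
  rw [sovCovec, List.ofFn_eq_map, skCovec_eq_skLabel, skCovec_eq_skLabel]
  refine (main _ _ (List.nodup_finRange N) (fun n => (topConf ℓ n).is_le) fun n _ => rfl).trans ?_
  simp

/-- Being a basis is a Zariski-open condition on the initial covector. -/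
theorem exists_mvPolynomial_of_isCovectorBasis {S₀ : Covec ℓ}
    (h₀ : IsCovectorBasis (sovCovec ℓ η ξ K k₂ S₀)) :
    ∃ P : MvPolynomial (Conf ℓ) ℂ, P ≠ 0 ∧
      ∀ S : Covec ℓ, MvPolynomial.eval S P ≠ 0 → IsCovectorBasis (sovCovec ℓ η ξ K k₂ S) := by
  obtain ⟨O, hO⟩ : ∃ O : Conf ℓ → Op ℓ, ∀ S h, sovCovec ℓ η ξ K k₂ S h = Matrix.vecMul S (O h) :=
    ⟨_, fun S h => rfl⟩
  -- The covectors depend linearly on S, so the matrix with these rows has linear forms in S as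
  -- entries; its determinant is the desired polynomial, nonzero because it does not vanish at S₀.
  let A : Matrix (Conf ℓ) (Conf ℓ) (MvPolynomial (Conf ℓ) ℂ) :=
    Matrix.of fun h x => ∑ y, MvPolynomial.X y * MvPolynomial.C (O h y x)
  have hA : ∀ S, MvPolynomial.eval S A.det = (Matrix.of (sovCovec ℓ η ξ K k₂ S)).det := by
    intro S
    rw [RingHom.map_det]
    congr 1
    ext h x
    simp [A, hO, Matrix.vecMul, dotProduct]
  have hiff : ∀ S, MvPolynomial.eval S A.det ≠ 0 ↔
      LinearIndependent ℂ (sovCovec ℓ η ξ K k₂ S) := by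
    intro S
    rw [hA, ← isUnit_iff_ne_zero, ← Matrix.isUnit_iff_isUnit_det,
      ← Matrix.linearIndependent_rows_iff_isUnit]
    rfl
  refine ⟨A.det, fun h => ?_, fun S hS => isCovectorBasis_of_linearIndependent ((hiff S).mp hS)⟩
  have := (hiff S₀).mpr h₀.1
  rw [h, map_zero] at this
  exact this rfl

end SeparateVariables

/-! ### Tensor products of operators -/

section Tensor

variable {ι : Type} [Fintype ι] {κ : ι → Type}

/-- The tensor product of the operators `f i`. -/
def tens (f : ∀ i, Matrix (κ i) (κ i) ℂ) : Matrix (∀ i, κ i) (∀ i, κ i) ℂ :=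
  Matrix.of fun x y => ∏ i, f i (x i) (y i)

theorem tens_mul [DecidableEq ι] [∀ i, Fintype (κ i)] (f g : ∀ i, Matrix (κ i) (κ i) ℂ) :
    tens f * tens g = tens fun i => f i * g i := by
  ext x y
  simp only [tens, Matrix.mul_apply, Matrix.of_apply, ← Finset.prod_mul_distrib]
  rw [Fintype.prod_sum]

theorem tens_one [∀ i, DecidableEq (κ i)] : tens (fun i => (1 : Matrix (κ i) (κ i) ℂ)) = 1 := by
  ext x y
  simp only [tens, Matrix.of_apply, Matrix.one_apply]
  split_ifs with h
  · subst h; simp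
  · obtain ⟨i, hi⟩ := Function.ne_iff.mp h
    exact Finset.prod_eq_zero (Finset.mem_univ i) (if_neg hi)

/-- The tensor product of `X` at `n` and of the operators `f i`, `i ≠ n`, linear in `X`. -/
def tensAt [DecidableEq ι] (f : ∀ i, Matrix (κ i) (κ i) ℂ) (n : ι) :
    Matrix (κ n) (κ n) ℂ →ₗ[ℂ] Matrix (∀ i, κ i) (∀ i, κ i) ℂ where
  toFun X := Matrix.of fun x y => X (x n) (y n) * ∏ i ∈ Finset.univ.erase n, f i (x i) (y i)
  map_add' X Y := by ext x y; simp [add_mul]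
  map_smul' c X := by ext x y; simp [mul_assoc]

variable [DecidableEq ι] [∀ i, DecidableEq (κ i)]

theorem embedAt_transpose (n : ι) (X : Matrix (κ n) (κ n) ℂ) :
    (embedAt n X).transpose = embedAt n X.transpose := by
  ext x y
  rw [Matrix.transpose_apply, embedAt_apply, embedAt_apply, Matrix.transpose_apply]
  simp only [eq_comm (b := x _)]

variable [∀ i, Fintype (κ i)]

theorem embedAt_mul_tens (f : ∀ i, Matrix (κ i) (κ i) ℂ) (n : ι) (X : Matrix (κ n) (κ n) ℂ) :
    embedAt n X * tens f = tensAt f n (X * f n) := by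
  ext x y
  rw [embedAt_mul_apply]
  simp only [tens, tensAt, LinearMap.coe_mk, AddHom.coe_mk, Matrix.of_apply, Matrix.mul_apply,
    Finset.sum_mul]
  refine Finset.sum_congr rfl fun c _ => ?_
  rw [← Finset.mul_prod_erase _ _ (Finset.mem_univ n), Function.update_self, mul_assoc]
  congr 2
  exact Finset.prod_congr rfl fun i hi => by
    rw [Function.update_of_ne (Finset.ne_of_mem_erase hi)]

theorem tens_mul_embedAt (f : ∀ i, Matrix (κ i) (κ i) ℂ) (n : ι) (X : Matrix (κ n) (κ n) ℂ) :
    tens f * embedAt n X = tensAt f n (f n * X) := by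
  have h := congrArg Matrix.transpose
    (embedAt_mul_tens (fun i => (f i).transpose) n X.transpose)
  rw [Matrix.transpose_mul, embedAt_transpose, ← Matrix.transpose_mul] at h
  exact h

end Tensor

/-! ### The fused matrices as restrictions to symmetric tensors -/

section SymmetricTensors

variable {m : ℕ}

/-- The isometry from `ℂ ^ (m + 1)` onto the symmetric tensors. -/
noncomputable def symMat (m : ℕ) : Matrix (Fin m → Fin 2) (Fin (m + 1)) ℂ :=
  Matrix.of fun x j => symVec m j x

theorem symMat_apply (x : Fin m → Fin 2) (j : Fin (m + 1)) : symMat m x j =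
    if ones x = (j : ℕ) then (((√(m.choose (j : ℕ) : ℝ))⁻¹ : ℝ) : ℂ) else 0 := rfl

theorem card_ones_eq (j : ℕ) :
    (Finset.univ.filter fun x : Fin m → Fin 2 => ones x = j).card = m.choose j := by
  rw [show m.choose j = (Finset.powersetCard j (Finset.univ : Finset (Fin m))).card by simp]
  refine Finset.card_bij' (fun x _ => Finset.univ.filter fun k => x k = 1)
    (fun s _ k => if k ∈ s then 1 else 0) (fun x hx => ?_) (fun s hs => ?_) (fun x hx => ?_)
    fun s hs => ?_
  · exact Finset.mem_powersetCard.mpr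
      ⟨Finset.subset_univ _, (Finset.mem_filter.mp hx).2⟩
  · refine Finset.mem_filter.mpr ⟨Finset.mem_univ _, ?_⟩
    simpa [Finset.mem_powersetCard, ones] using hs
  · funext k
    simp only [Finset.mem_filter, Finset.mem_univ, true_and]
    split_ifs <;> omega
  · simp

theorem ones_le (x : Fin m → Fin 2) : ones x ≤ m :=
  (Finset.card_filter_le _ _).trans (by simp)

theorem inv_sqrt_choose_sq {j : ℕ} (hj : j ≤ m) : (m.choose j : ℂ) *
    ((((√(m.choose j : ℝ))⁻¹ : ℝ) : ℂ) * (((√(m.choose j : ℝ))⁻¹ : ℝ) : ℂ)) = 1 := by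
  have hpos : (0 : ℝ) < m.choose j := by exact_mod_cast Nat.choose_pos hj
  rw [← Complex.ofReal_mul, ← mul_inv, Real.mul_self_sqrt hpos.le, Complex.ofReal_inv,
    Complex.ofReal_natCast, mul_inv_cancel₀]
  exact_mod_cast hpos.ne'

theorem symMat_transpose_mul : (symMat m).transpose * symMat m = 1 := by
  ext i j
  simp only [Matrix.mul_apply, Matrix.transpose_apply, symMat_apply, Matrix.one_apply, ite_mul,
    mul_ite, mul_zero, zero_mul]
  split_ifs with hij
  · subst hij
    rw [← inv_sqrt_choose_sq (Nat.lt_succ_iff.mp i.2), ← card_ones_eq, ← nsmul_eq_mul,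
      ← Finset.sum_const, Finset.sum_filter]
    refine Finset.sum_congr rfl fun x _ => ?_
    split_ifs <;> rfl
  · refine Finset.sum_eq_zero fun x _ => ?_
    split_ifs with h1 h2
    · exact absurd (Fin.ext (h1.symm.trans h2)) (by first | exact hij | exact fun e => hij e.symm)
    · rfl
    · rfl

/-- `symMat * symMatᵀ` fixes the symmetric tensors. -/
theorem symMat_mul_transpose_mul {μ : Type} (Z : Matrix (Fin m → Fin 2) μ ℂ)
    (hZ : ∀ x (π : Equiv.Perm (Fin m)) j, Z (x ∘ π) j = Z x j) :
    symMat m * ((symMat m).transpose * Z) = Z := by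
  ext x j
  have hx : ones x < m + 1 := Nat.lt_succ_iff.mpr (ones_le x)
  simp only [Matrix.mul_apply, Matrix.transpose_apply]
  rw [Finset.sum_eq_single ⟨ones x, hx⟩]
  · simp only [symMat_apply, if_true, ite_mul, zero_mul]
    rw [← Finset.sum_filter, Finset.sum_congr rfl (g := fun _ =>
      (((√(m.choose (ones x) : ℝ))⁻¹ : ℝ) : ℂ) * Z x j), Finset.sum_const, card_ones_eq,
      nsmul_eq_mul]
    · linear_combination (Z x j) * inv_sqrt_choose_sq (ones_le x)
    · intro y hy
      obtain ⟨π, rfl⟩ := exists_perm_of_ones_eq (Finset.mem_filter.mp hy).2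
      rw [hZ]
  · intro i _ hi
    rw [symMat_apply, if_neg, zero_mul]
    intro h
    exact hi (Fin.ext h.symm)
  · simp

/-- `W ⊗ ⋯ ⊗ W`. -/
def tensPow (m : ℕ) (W : Matrix (Fin 2) (Fin 2) ℂ) :
    Matrix (Fin m → Fin 2) (Fin m → Fin 2) ℂ := tens fun _ => W

theorem fusedTwist_eq (W : Matrix (Fin 2) (Fin 2) ℂ) :
    fusedTwist m W = (symMat m).transpose * (tensPow m W * symMat m) := by
  ext i j
  simp only [fusedTwist, Matrix.of_apply, Matrix.mul_apply, Matrix.transpose_apply, symMat,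
    tensPow, tens, Finset.mul_sum, mul_assoc]

theorem tensPow_comp (W : Matrix (Fin 2) (Fin 2) ℂ) (x y : Fin m → Fin 2)
    (π : Equiv.Perm (Fin m)) : tensPow m W (x ∘ π) (y ∘ π) = tensPow m W x y :=
  Fintype.prod_equiv π _ _ fun _ => rfl

theorem symMat_comp (x : Fin m → Fin 2) (π : Equiv.Perm (Fin m)) (j : Fin (m + 1)) :
    symMat m (x ∘ π) j = symMat m x j := by
  rw [symMat_apply, symMat_apply, ones_comp]

/-- W^{⊗m} preserves the symmetric tensors, so the projection hidden in `fusedTwist` acts as the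
identity. With the injectivity of `symMat`, this makes `fusedTwist` multiplicative. -/
theorem symMat_mul_fusedTwist (W : Matrix (Fin 2) (Fin 2) ℂ) :
    symMat m * fusedTwist m W = tensPow m W * symMat m := by
  rw [fusedTwist_eq, symMat_mul_transpose_mul]
  intro x π j
  rw [Matrix.mul_apply, Matrix.mul_apply]
  symm
  refine Fintype.sum_equiv (π.symm.arrowCongr (Equiv.refl _)) _ _ fun y => ?_
  change _ = tensPow m W (x ∘ π) (y ∘ π) * symMat m (y ∘ π) j
  rw [tensPow_comp, symMat_comp]

theorem symMat_mul_cancel {μ : Type} {Y Z : Matrix (Fin (m + 1)) μ ℂ}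
    (h : symMat m * Y = symMat m * Z) : Y = Z := by
  have := congrArg ((symMat m).transpose * ·) h
  simpa only [← Matrix.mul_assoc, symMat_transpose_mul, Matrix.one_mul] using this

theorem fusedTwist_mul (W W' : Matrix (Fin 2) (Fin 2) ℂ) :
    fusedTwist m W * fusedTwist m W' = fusedTwist m (W * W') := by
  refine symMat_mul_cancel ?_
  rw [← Matrix.mul_assoc, symMat_mul_fusedTwist, Matrix.mul_assoc, symMat_mul_fusedTwist,
    ← Matrix.mul_assoc, symMat_mul_fusedTwist, tensPow, tensPow, tens_mul]
  rfl

theorem fusedTwist_one : fusedTwist m 1 = 1 := by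
  refine symMat_mul_cancel ?_
  rw [symMat_mul_fusedTwist, tensPow, tens_one, Matrix.one_mul, Matrix.mul_one]

end SymmetricTensors

/-! ### GL₂ covariance of the Lax operator -/

section LaxCovariance

variable {m : ℕ}

/-- The total action of `gl₂` on `(ℂ²)^{⊗ m}`: the sum over the factors of the matrix unit
`e_{ji}`. -/
def tensUnit (m : ℕ) (i j : Fin 2) : Matrix (Fin m → Fin 2) (Fin m → Fin 2) ℂ :=
  ∑ k, embedAt (κ := fun _ : Fin m => Fin 2) k (Matrix.single j i 1)

theorem tensUnit_mul_apply {μ : Type} (i j : Fin 2) (Z : Matrix (Fin m → Fin 2) μ ℂ)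
    (x : Fin m → Fin 2) (y : μ) : (tensUnit m i j * Z) x y =
      ∑ k with x k = j, Z (Function.update x k i) y := by
  rw [tensUnit, Matrix.sum_mul, Matrix.sum_apply, Finset.sum_filter]
  refine Finset.sum_congr rfl fun k _ => ?_
  rw [embedAt_mul_apply]
  by_cases h : x k = j
  · subst h
    simp [Matrix.single_apply]
  · simp [h, Ne.symm h]

theorem ones_update_one {x : Fin m → Fin 2} {k : Fin m} (hk : x k = 0) :
    ones (Function.update x k 1) = ones x + 1 := by
  have h : (Finset.univ.filter fun l => Function.update x k 1 l = 1) =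
      insert k (Finset.univ.filter fun l => x l = 1) := by
    ext l
    by_cases hl : l = k
    · subst hl; simp
    · simp [hl]
  rw [ones, h, Finset.card_insert_of_notMem (by simp [hk])]
  rfl

theorem ones_update_zero {x : Fin m → Fin 2} {k : Fin m} (hk : x k = 1) :
    ones (Function.update x k 0) + 1 = ones x := by
  have h := ones_update_one (x := Function.update x k 0) (k := k) (by simp)
  rw [Function.update_idem, ← hk, Function.update_eq_self] at h
  exact h.symm

theorem card_zeros (x : Fin m → Fin 2) :
    ((Finset.univ.filter fun k => x k = 0).card : ℂ) = m - ones x := by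
  have h := Finset.card_filter_add_card_filter_not (s := (Finset.univ : Finset (Fin m)))
    (fun k => x k = 1)
  rw [Finset.card_univ, Fintype.card_fin] at h
  have h2 : (Finset.univ.filter fun k => ¬x k = 1) = Finset.univ.filter fun k => x k = 0 :=
    Finset.filter_congr fun k _ => by omega
  rw [h2] at h
  rw [eq_sub_iff_add_eq, add_comm]
  exact_mod_cast h

/-- The action of `gl₂` on `ℂ ^ (m + 1)`. -/
noncomputable def spinUnit (m : ℕ) : Matrix (Fin 2) (Fin 2) (Matrix (Fin (m + 1)) (Fin (m + 1)) ℂ) :=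
  !![((m : ℂ) / 2) • 1 + spinZ m, spinMinus m; spinPlus m, ((m : ℂ) / 2) • 1 - spinZ m]

theorem sqrt_mul_choose {j : ℕ} (hj : j < m) : √(((j : ℝ) + 1) * ((m : ℝ) - (j : ℝ))) =
    ((j : ℝ) + 1) * (√(m.choose (j + 1) : ℝ) / √(m.choose j : ℝ)) := by
  have hpos : (0 : ℝ) < m.choose j := by exact_mod_cast Nat.choose_pos hj.le
  have h : (m.choose (j + 1) : ℝ) * ((j : ℝ) + 1) = m.choose j * ((m : ℝ) - (j : ℝ)) := by
    rw [← Nat.cast_sub hj.le]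
    exact_mod_cast Nat.choose_succ_right_eq m j
  have h2 : ((j : ℝ) + 1) * ((m : ℝ) - (j : ℝ)) =
      ((j : ℝ) + 1) ^ 2 * ((m.choose (j + 1) : ℝ) / m.choose j) := by
    field_simp
    linear_combination (-1 : ℝ) * h
  rw [h2, Real.sqrt_mul (sq_nonneg _), Real.sqrt_sq (by positivity),
    Real.sqrt_div (Nat.cast_nonneg _)]

theorem sqrt_choose_succ {j : ℕ} (hj : j < m) :
    (((√(m.choose (j + 1) : ℝ))⁻¹ : ℝ) : ℂ) *
      ((√(((j : ℝ) + 1) * ((m : ℝ) - (j : ℝ))) : ℝ) : ℂ) =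
        ((j : ℂ) + 1) * (((√(m.choose j : ℝ))⁻¹ : ℝ) : ℂ) := by
  have hb : √(m.choose (j + 1) : ℝ) ≠ 0 :=
    (Real.sqrt_pos.mpr (by exact_mod_cast Nat.choose_pos hj)).ne'
  rw [sqrt_mul_choose hj]
  norm_cast
  push_cast
  field_simp

theorem sqrt_choose_succ' {j : ℕ} (hj : j < m) :
    (((√(m.choose j : ℝ))⁻¹ : ℝ) : ℂ) *
      ((√(((j : ℝ) + 1) * ((m : ℝ) - (j : ℝ))) : ℝ) : ℂ) =
        ((m : ℂ) - j) * (((√(m.choose (j + 1) : ℝ))⁻¹ : ℝ) : ℂ) := by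
  have hpos : (0 : ℝ) < ((j : ℝ) + 1) * ((m : ℝ) - (j : ℝ)) :=
    mul_pos (by positivity) (sub_pos.mpr (by exact_mod_cast hj))
  have h := sqrt_choose_succ hj
  have hs := ofReal_sqrt_sq hpos.le
  push_cast at hs
  have hj' : ((j : ℂ) + 1) ≠ 0 := Nat.cast_add_one_ne_zero j
  refine mul_left_cancel₀ hj' ?_
  rw [← mul_assoc, ← h, mul_assoc, hs]
  ring

/-- The spin matrices are the restriction of the total gl₂ action to symmetric tensors. Diagonal
entries count letters; off the diagonal, the square roots in S^± match ratios of the norms √(m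
choose j). -/
theorem symMat_mul_spinUnit (i j : Fin 2) :
    symMat m * spinUnit m i j = tensUnit m i j * symMat m := by
  ext x c
  rw [tensUnit_mul_apply]
  have hx := ones_le x
  have hc := c.is_le
  fin_cases i <;> fin_cases j
  · have h : spinUnit m 0 0 = Matrix.diagonal fun i : Fin (m + 1) => (m : ℂ) - (i : ℕ) := by
      simp only [spinUnit, Matrix.of_apply, Matrix.cons_val', Matrix.cons_val_zero,
        Matrix.cons_val_fin_one, spinZ]
      rw [← Matrix.diagonal_one, ← Matrix.diagonal_smul, Matrix.diagonal_add]
      congr 1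
      funext i
      simp
      ring
    change (symMat m * spinUnit m 0 0) x c =
      ∑ k with x k = 0, symMat m (Function.update x k 0) c
    rw [h, Matrix.mul_diagonal, Finset.sum_congr rfl (g := fun _ => symMat m x c)
      fun k hk => by
        rw [← (Finset.mem_filter.mp hk).2, Function.update_eq_self],
      Finset.sum_const, nsmul_eq_mul, card_zeros, symMat_apply]
    split_ifs with h
    · rw [h, mul_comm]
    · simp
  · change (symMat m * spinMinus m) x c = ∑ k with x k = 1, symMat m (Function.update x k 0) c
    rw [Matrix.mul_apply, Finset.sum_eq_single ⟨ones x, Nat.lt_succ_iff.mpr hx⟩]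
    · rw [symMat_apply, if_pos rfl, spinMinus, Matrix.transpose_apply, spinPlus_apply]
      by_cases h : ones x = (c : ℕ) + 1
      · rw [if_pos h, Finset.sum_congr rfl (g := fun _ =>
          (((√(m.choose (c : ℕ) : ℝ))⁻¹ : ℝ) : ℂ)) fun k hk => by
            rw [symMat_apply, if_pos]
            have := ones_update_zero (Finset.mem_filter.mp hk).2
            omega, Finset.sum_const, nsmul_eq_mul]
        change (((√(m.choose (ones x) : ℝ))⁻¹ : ℝ) : ℂ) * _ = (ones x : ℂ) * _
        rw [h, sqrt_choose_succ (by omega)]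
        push_cast; rfl
      · rw [if_neg h, mul_zero]
        refine (Finset.sum_eq_zero fun k hk => ?_).symm
        rw [symMat_apply, if_neg]
        have := ones_update_zero (Finset.mem_filter.mp hk).2
        omega
    · intro b _ hb
      rw [symMat_apply, if_neg, zero_mul]
      intro h
      exact hb (Fin.ext h.symm)
    · simp
  · change (symMat m * spinPlus m) x c = ∑ k with x k = 0, symMat m (Function.update x k 1) c
    rw [Matrix.mul_apply, Finset.sum_eq_single ⟨ones x, Nat.lt_succ_iff.mpr hx⟩]
    · rw [symMat_apply, if_pos rfl, spinPlus_apply]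
      by_cases h : (c : ℕ) = ones x + 1
      · rw [if_pos h, Finset.sum_congr rfl (g := fun _ =>
          (((√(m.choose (ones x + 1) : ℝ))⁻¹ : ℝ) : ℂ)) fun k hk => by
            rw [symMat_apply, if_pos, h]
            rw [ones_update_one (Finset.mem_filter.mp hk).2, h],
          Finset.sum_const, nsmul_eq_mul, card_zeros]
        exact sqrt_choose_succ' (j := ones x) (by omega)
      · rw [if_neg h, mul_zero]
        refine (Finset.sum_eq_zero fun k hk => ?_).symm
        rw [symMat_apply, if_neg]
        rw [ones_update_one (Finset.mem_filter.mp hk).2]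
        omega
    · intro b _ hb
      rw [symMat_apply, if_neg, zero_mul]
      intro h
      exact hb (Fin.ext h.symm)
    · simp
  · have h : spinUnit m 1 1 = Matrix.diagonal fun i : Fin (m + 1) => ((i : ℕ) : ℂ) := by
      simp only [spinUnit, Matrix.of_apply, Matrix.cons_val', Matrix.cons_val_one,
        Matrix.cons_val_fin_one, spinZ]
      rw [← Matrix.diagonal_one, ← Matrix.diagonal_smul, Matrix.diagonal_sub]
      congr 1
      funext i
      simp
    change (symMat m * spinUnit m 1 1) x c =
      ∑ k with x k = 1, symMat m (Function.update x k 1) c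
    rw [h, Matrix.mul_diagonal, Finset.sum_congr rfl (g := fun _ => symMat m x c)
      fun k hk => by
        rw [← (Finset.mem_filter.mp hk).2, Function.update_eq_self],
      Finset.sum_const, nsmul_eq_mul, symMat_apply]
    change _ = (ones x : ℂ) * _
    split_ifs with h
    · rw [h, mul_comm]
    · simp

/-- As a matrix in i, j, `tensUnit` is the sum of the permutation operators exchanging the auxiliary
space with each factor, and these commute with W ⊗ W^{⊗m}. -/
theorem tensPow_tensUnit (W : Matrix (Fin 2) (Fin 2) ℂ) (i j : Fin 2) :
    ∑ p, W i p • (tensPow m W * tensUnit m p j) = ∑ p, W p j • (tensUnit m i p * tensPow m W) := by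
  simp only [tensUnit, tensPow, Finset.mul_sum, Finset.sum_mul, tens_mul_embedAt,
    embedAt_mul_tens, Finset.smul_sum]
  rw [Finset.sum_comm, Finset.sum_comm (s := (Finset.univ : Finset (Fin 2)))]
  refine Finset.sum_congr rfl fun k _ => ?_
  simp only [← map_smul, ← map_sum]
  congr 1
  ext a b
  simp only [Matrix.sum_apply, Matrix.smul_apply, Matrix.mul_apply, Matrix.single_apply]
  fin_cases i <;> fin_cases j <;> fin_cases a <;> fin_cases b <;>
    simp [Fin.sum_univ_two] <;> ring

theorem fusedTwist_spinUnit (W : Matrix (Fin 2) (Fin 2) ℂ) (i j : Fin 2) :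
    ∑ p, W i p • (fusedTwist m W * spinUnit m p j) =
      ∑ p, W p j • (spinUnit m i p * fusedTwist m W) := by
  refine symMat_mul_cancel ?_
  have h := congrArg (· * symMat m) (tensPow_tensUnit (m := m) W i j)
  simp only [Matrix.sum_mul, Matrix.smul_mul, Matrix.mul_assoc] at h
  simp only [Matrix.mul_sum, Matrix.mul_smul, ← Matrix.mul_assoc, symMat_mul_fusedTwist,
    symMat_mul_spinUnit]
  simp only [Matrix.mul_assoc, symMat_mul_fusedTwist, symMat_mul_spinUnit]
  exact h

theorem localLax_eq (η u : ℂ) (i j : Fin 2) : localLax m η u i j =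
    (if i = j then (u + η / 2 - η * m / 2) else 0) • 1 + η • spinUnit m i j := by
  fin_cases i <;> fin_cases j <;> simp [localLax, spinUnit] <;> module

theorem fusedTwist_localLax (W : Matrix (Fin 2) (Fin 2) ℂ) (η u : ℂ) (i j : Fin 2) :
    ∑ p, W i p • (fusedTwist m W * localLax m η u p j) =
      ∑ p, W p j • (localLax m η u i p * fusedTwist m W) := by
  simp only [localLax_eq, mul_add, add_mul, smul_add, Finset.sum_add_distrib, ite_smul, zero_smul,
    mul_ite, ite_mul, mul_zero, zero_mul, smul_ite, smul_zero, mul_smul_comm, smul_mul_assoc,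
    mul_one, one_mul, Finset.sum_ite_eq, Finset.sum_ite_eq', Finset.mem_univ, if_true]
  congr 1
  have hη : ∀ (c : ℂ) (X : Matrix (Fin (m + 1)) (Fin (m + 1)) ℂ), c • η • X = η • c • X :=
    fun c X => smul_comm c η X
  simp only [hη, ← Finset.smul_sum]
  rw [fusedTwist_spinUnit]

end LaxCovariance

theorem ofFn_prod_semiconj {R : Type*} [Monoid R] {N : ℕ} (S : R) (f g : Fin N → R)
    (h : ∀ n, S * f n = g n * S) : S * (List.ofFn f).prod = (List.ofFn g).prod * S := by
  induction N with
  | zero => simp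
  | succ N ih =>
    rw [List.ofFn_succ, List.ofFn_succ, List.prod_cons, List.prod_cons, ← mul_assoc, h, mul_assoc,
      ih _ _ fun n => h n.succ, mul_assoc]

/-! ### Scalar matrices and traces over the auxiliary spaces -/

section ScalarMatrices

variable {R : Type*} [Ring R] [Algebra ℂ R] {n : Type*} [Fintype n]

theorem trace_map_mul_comm (A : Matrix n n ℂ) (Z : Matrix n n R) :
    (A.map (algebraMap ℂ R) * Z).trace = (Z * A.map (algebraMap ℂ R)).trace := by
  simp only [Matrix.trace, Matrix.diag_apply, Matrix.mul_apply, Matrix.map_apply,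
    Algebra.commutes]
  exact Finset.sum_comm

theorem commute_diagonal_map [DecidableEq n] (S : R) (A : Matrix n n ℂ) :
    Commute (Matrix.diagonal fun _ : n => S) (A.map (algebraMap ℂ R)) := by
  ext i j
  rw [Matrix.diagonal_mul, Matrix.mul_diagonal, Matrix.map_apply, Algebra.commutes]

theorem map_mul_map (A B : Matrix n n ℂ) :
    (A * B).map (algebraMap ℂ R) = A.map (algebraMap ℂ R) * B.map (algebraMap ℂ R) :=
  Matrix.map_mul

theorem trace_lower_mul (Z : Matrix (Fin 2) (Fin 2) R) :
    ((!![0, 0; 1, 0] : Matrix (Fin 2) (Fin 2) ℂ).map (algebraMap ℂ R) * Z).trace = Z 0 1 := by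
  simp [Matrix.trace_fin_two, Matrix.mul_apply, Fin.sum_univ_two]

end ScalarMatrices

section FusedTrace

variable {R : Type} [Ring R] {m : ℕ}

/-- The matrix `M₁ ⋯ M_m` on the tensor product of `m` auxiliary spaces. -/
def auxProd (M : Fin m → Matrix (Fin 2) (Fin 2) R) :
    Matrix (Fin m → Fin 2) (Fin m → Fin 2) R :=
  Matrix.of fun x y => (List.ofFn fun k => M k (x k) (y k)).prod

theorem auxProd_eq (M : Fin m → Matrix (Fin 2) (Fin 2) R) : auxProd M =
    (List.ofFn fun k : Fin m => embedAt (κ := fun _ : Fin m => Fin 2) k (M k)).prod := by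
  ext x y
  rw [embedAt_ofFn_prod_apply]
  rfl

theorem auxProd_succ (M : Fin (m + 1) → Matrix (Fin 2) (Fin 2) R) (x y : Fin (m + 1) → Fin 2) :
    auxProd M x y = M 0 (x 0) (y 0) * auxProd (fun k => M k.succ) (Fin.tail x) (Fin.tail y) := by
  simp only [auxProd, Matrix.of_apply, List.ofFn_succ, List.prod_cons, Fin.tail]

theorem tensPow_succ (W : Matrix (Fin 2) (Fin 2) ℂ) (x y : Fin (m + 1) → Fin 2) :
    tensPow (m + 1) W x y = W (x 0) (y 0) * tensPow m W (Fin.tail x) (Fin.tail y) :=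
  Fin.prod_univ_succ _

theorem sum_cons {V : Type*} [AddCommMonoid V] (F : (Fin (m + 1) → Fin 2) → V) :
    ∑ x, F x = ∑ i, ∑ x : Fin m → Fin 2, F (Fin.cons i x) := by
  rw [← Fintype.sum_equiv (Fin.consEquiv fun _ : Fin (m + 1) => Fin 2) _ _ fun x => rfl,
    Fintype.sum_prod_type]
  rfl

variable [Algebra ℂ R]

theorem auxProd_map_mul (W : Matrix (Fin 2) (Fin 2) ℂ) (M : Fin m → Matrix (Fin 2) (Fin 2) R) :
    auxProd (fun k => W.map (algebraMap ℂ R) * M k) =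
      (tensPow m W).map (algebraMap ℂ R) * auxProd M := by
  induction m with
  | zero =>
    ext x y
    simp [auxProd, tensPow, tens, Matrix.mul_apply]
  | succ m ih =>
    ext x y
    rw [auxProd_succ, ih fun k => M k.succ, Matrix.mul_apply, Matrix.mul_apply, Matrix.mul_apply,
      sum_cons, Finset.sum_mul_sum]
    refine Finset.sum_congr rfl fun a _ => Finset.sum_congr rfl fun p _ => ?_
    rw [auxProd_succ, Matrix.map_apply, Matrix.map_apply, Matrix.map_apply, tensPow_succ, map_mul,
      Fin.cons_zero, Fin.tail_cons, mul_assoc, mul_assoc,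
      Algebra.left_comm (M 0 a (y 0))]

theorem auxProd_mul_map (W : Matrix (Fin 2) (Fin 2) ℂ) (M : Fin m → Matrix (Fin 2) (Fin 2) R) :
    auxProd (fun k => M k * W.map (algebraMap ℂ R)) =
      auxProd M * (tensPow m W).map (algebraMap ℂ R) := by
  induction m with
  | zero =>
    ext x y
    simp [auxProd, tensPow, tens, Matrix.mul_apply]
  | succ m ih =>
    ext x y
    rw [auxProd_succ, ih fun k => M k.succ, Matrix.mul_apply, Matrix.mul_apply, Matrix.mul_apply,
      sum_cons, Finset.sum_mul_sum]
    refine Finset.sum_congr rfl fun a _ => Finset.sum_congr rfl fun p _ => ?_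
    rw [auxProd_succ, Matrix.map_apply, Matrix.map_apply, Matrix.map_apply, tensPow_succ, map_mul,
      Fin.cons_zero, Fin.tail_cons, mul_assoc, mul_assoc,
      Algebra.left_comm (auxProd _ _ _)]

/-- The trace of `P⁺ M₁ ⋯ M_m P⁺` over the auxiliary spaces. -/
noncomputable def fusedTrace (M : Fin m → Matrix (Fin 2) (Fin 2) R) : R :=
  ((symProj m).map (algebraMap ℂ R) * auxProd M * (symProj m).map (algebraMap ℂ R)).trace

theorem symProj_commute_tensPow (W : Matrix (Fin 2) (Fin 2) ℂ) :
    Commute (symProj m) (tensPow m W) := by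
  refine Commute.smul_left (Commute.sum_left _ _ _ fun π _ => ?_) _
  ext x y
  rw [Matrix.mul_apply, Matrix.mul_apply, Finset.sum_eq_single (x ∘ π.symm),
    Finset.sum_eq_single (y ∘ π)]
  · rw [permOp, Matrix.of_apply, Matrix.of_apply, if_pos (by funext k; simp), if_pos rfl, one_mul,
      mul_one, ← tensPow_comp W _ _ π, Function.comp_assoc]
    simp
  · intro z _ hz
    rw [permOp, Matrix.of_apply, if_neg hz, mul_zero]
  · simp
  · intro z _ hz
    rw [permOp, Matrix.of_apply, if_neg, zero_mul]
    rintro rfl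
    exact hz (by funext k; simp)
  · simp

/-- Conjugating every factor conjugates the whole product by W^{⊗m}, which commutes with P⁺.
Cyclicity is used only for scalar matrices, as the entries do not commute. -/
theorem fusedTrace_conj {W W' : Matrix (Fin 2) (Fin 2) ℂ} (hW : W * W' = 1)
    (M : Fin m → Matrix (Fin 2) (Fin 2) R) :
    fusedTrace (fun k => W'.map (algebraMap ℂ R) * M k * W.map (algebraMap ℂ R)) =
      fusedTrace M := by
  have hP : ∀ V : Matrix (Fin 2) (Fin 2) ℂ, Commute ((symProj m).map (algebraMap ℂ R))
      ((tensPow m V).map (algebraMap ℂ R)) := by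
    intro V
    rw [Commute, SemiconjBy, ← map_mul_map, ← map_mul_map, (symProj_commute_tensPow V).eq]
  have hT : (tensPow m W).map (algebraMap ℂ R) * (tensPow m W').map (algebraMap ℂ R) = 1 := by
    rw [← map_mul_map, tensPow, tensPow, tens_mul, hW, tens_one]
    simp
  rw [fusedTrace, fusedTrace, auxProd_mul_map W (fun k => W'.map (algebraMap ℂ R) * M k),
    auxProd_map_mul, mul_assoc, mul_assoc, mul_assoc, ← (hP W).eq, ← mul_assoc, (hP W').eq,
    mul_assoc, trace_map_mul_comm]
  simp only [mul_assoc, hT, mul_one]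

theorem fusedTrace_semiconj (S : R) (M M' : Fin m → Matrix (Fin 2) (Fin 2) R)
    (h : ∀ k i j, S * M k i j = M' k i j * S) : S * fusedTrace M = fusedTrace M' * S := by
  have hX : Matrix.diagonal (fun _ => S) * auxProd M =
      auxProd M' * Matrix.diagonal fun _ => S := by
    ext x y
    rw [Matrix.diagonal_mul, Matrix.mul_diagonal]
    exact ofFn_prod_semiconj S _ _ fun k => h k _ _
  have hP := commute_diagonal_map S (symProj m)
  have key : Matrix.diagonal (fun _ => S) * ((symProj m).map (algebraMap ℂ R) * auxProd M *
      (symProj m).map (algebraMap ℂ R)) = (symProj m).map (algebraMap ℂ R) * auxProd M' *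
      (symProj m).map (algebraMap ℂ R) * Matrix.diagonal fun _ => S := by
    rw [← mul_assoc, ← mul_assoc, hP.eq, mul_assoc (Matrix.map _ _) (Matrix.diagonal _), hX,
      ← mul_assoc, mul_assoc _ (Matrix.diagonal _), hP.eq, ← mul_assoc]
  have h2 := congrArg Matrix.trace key
  simpa only [fusedTrace, Matrix.trace, Matrix.diag_apply, Matrix.diagonal_mul, Matrix.mul_diagonal,
    ← Finset.mul_sum, ← Finset.sum_mul] using h2

end FusedTrace

/-! ### Conjugation of the twist on the whole chain -/

section GlobalCovariance

variable {N : ℕ} (ℓ : Fin N → ℕ) (η : ℂ) (ξ : Fin N → ℂ) (W K : Matrix (Fin 2) (Fin 2) ℂ)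

theorem fusedTransfer_eq (m : ℕ) (u : ℂ) : fusedTransfer ℓ η ξ K m u =
    fusedTrace fun k : Fin m => monodromy ℓ η ξ K (u + ((m : ℂ) - 1 - (k : ℕ)) * η) := by
  rw [fusedTrace, auxProd_eq]
  rfl

theorem globalTwist_eq : globalTwist ℓ W =
    tens (κ := fun n => Fin (ℓ n + 1)) fun n => fusedTwist (ℓ n) W := rfl

theorem globalTwist_mul (W' : Matrix (Fin 2) (Fin 2) ℂ) :
    globalTwist ℓ W * globalTwist ℓ W' = globalTwist ℓ (W * W') := by
  simp only [globalTwist_eq, tens_mul, fusedTwist_mul]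

theorem globalTwist_one : globalTwist ℓ 1 = 1 := by
  simp only [globalTwist_eq, fusedTwist_one, tens_one]

variable {W} in
theorem globalTwist_mul_inv (hW : IsUnit W.det) :
    globalTwist ℓ W * (globalTwist ℓ W)⁻¹ = 1 ∧ (globalTwist ℓ W)⁻¹ * globalTwist ℓ W = 1 := by
  have h : IsUnit (globalTwist ℓ W).det := Matrix.isUnit_det_of_right_inverse
    (B := globalTwist ℓ W⁻¹) (by rw [globalTwist_mul, Matrix.mul_nonsing_inv _ hW, globalTwist_one])
  exact ⟨Matrix.mul_nonsing_inv _ h, Matrix.nonsing_inv_mul _ h⟩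

theorem commute_twist_lax (n : Fin N) (u : ℂ) :
    Commute (Matrix.diagonal (fun _ => globalTwist ℓ W) * W.map (algebraMap ℂ (Op ℓ)))
      (lax ℓ η n u) := by
  ext i j : 2
  rw [Matrix.mul_apply, Matrix.mul_apply]
  simp only [Matrix.diagonal_mul, Matrix.map_apply, ← Algebra.commutes, ← Algebra.smul_def,
    smul_mul_assoc, mul_smul_comm, lax_eq_map, embedHom_apply, globalTwist_eq, tens_mul_embedAt,
    embedAt_mul_tens]
  simp only [← map_smul, ← map_sum]
  rw [fusedTwist_localLax]

/-- The product of 𝒲 with W in the auxiliary space commutes with every Lax operator. Hence 𝒲 passes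
through the Lax product at the cost of conjugating the latter by W in the auxiliary space. -/
theorem twist_mul_monodromy (u : ℂ) (i j : Fin 2) :
    globalTwist ℓ W * monodromy ℓ η ξ (conjTwist W K) u i j =
      (W⁻¹.map (algebraMap ℂ (Op ℓ)) * monodromy ℓ η ξ K u * W.map (algebraMap ℂ (Op ℓ))) i j *
        globalTwist ℓ W := by
  have hP : Commute (Matrix.diagonal (fun _ => globalTwist ℓ W) * W.map (algebraMap ℂ (Op ℓ)))
      (laxProd ℓ η ξ (List.finRange N).reverse u) := by
    refine Commute.list_prod_right _ _ fun y hy => ?_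
    obtain ⟨n, -, rfl⟩ := List.mem_map.mp hy
    exact commute_twist_lax ℓ η W n _
  have hD : ∀ A : Matrix (Fin 2) (Fin 2) ℂ, Matrix.diagonal (fun _ => globalTwist ℓ W) *
      A.map (algebraMap ℂ (Op ℓ)) = A.map (algebraMap ℂ (Op ℓ)) *
        Matrix.diagonal (fun _ => globalTwist ℓ W) := fun A => (commute_diagonal_map _ A).eq
  have key : Matrix.diagonal (fun _ => globalTwist ℓ W) * monodromy ℓ η ξ (conjTwist W K) u =
      (W⁻¹.map (algebraMap ℂ (Op ℓ)) * monodromy ℓ η ξ K u * W.map (algebraMap ℂ (Op ℓ))) *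
        Matrix.diagonal (fun _ => globalTwist ℓ W) := by
    rw [monodromy_eq, monodromy_eq, conjTwist, map_mul_map, mul_assoc (Matrix.map (W⁻¹ * K) _),
      ← mul_assoc (Matrix.diagonal _), hD, mul_assoc (Matrix.map (W⁻¹ * K) _),
      ← mul_assoc (Matrix.diagonal _), hP.eq, hD, map_mul_map]
    simp only [mul_assoc]
  have h := congrFun (congrFun key i) j
  rwa [Matrix.diagonal_mul, Matrix.mul_diagonal] at h

theorem twist_mul_fusedTransfer (hW : IsUnit W.det) (m : ℕ) (u : ℂ) :
    globalTwist ℓ W * fusedTransfer ℓ η ξ (conjTwist W K) m u =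
      fusedTransfer ℓ η ξ K m u * globalTwist ℓ W := by
  rw [fusedTransfer_eq, fusedTransfer_eq, ← fusedTrace_conj (Matrix.mul_nonsing_inv W hW)
    (fun k : Fin m => monodromy ℓ η ξ K (u + ((m : ℂ) - 1 - (k : ℕ)) * η))]
  exact fusedTrace_semiconj _ _ _ fun k i j => twist_mul_monodromy ℓ η ξ W K _ i j

theorem twist_mul_opB (u : ℂ) :
    globalTwist ℓ W * opB ℓ η ξ (conjTwist W K) u =
      opBTilde ℓ η ξ K W u * globalTwist ℓ W := by
  have h : opBTilde ℓ η ξ K W u = (W⁻¹.map (algebraMap ℂ (Op ℓ)) * monodromy ℓ η ξ K u *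
      W.map (algebraMap ℂ (Op ℓ))) 0 1 := by
    rw [opBTilde, mul_assoc W, map_mul_map, mul_assoc, trace_map_mul_comm, map_mul_map, mul_assoc,
      mul_assoc, ← mul_assoc (Matrix.map W⁻¹ _), trace_lower_mul]
  rw [opB, twist_mul_monodromy, h]

end GlobalCovariance

/-! ### Transport of the covectors to a twist with b = 0 -/

section Twisted

variable {N : ℕ} {ℓ : Fin N → ℕ} {η : ℂ} {ξ : Fin N → ℂ}
  {K W : Matrix (Fin 2) (Fin 2) ℂ} {k₁ k₂ : ℂ}

theorem det_eq_of_charpoly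
    (hk : K.charpoly = (Polynomial.X - Polynomial.C k₁) * (Polynomial.X - Polynomial.C k₂)) :
    K.det = k₁ * k₂ := by
  rw [Matrix.det_eq_sign_charpoly_coeff, hk]
  simp [Polynomial.mul_coeff_zero]

theorem vecMul_inv_twist (hW : IsUnit W.det) {X Y : Op ℓ}
    (h : globalTwist ℓ W * X = Y * globalTwist ℓ W) (v : Covec ℓ) :
    Matrix.vecMul (Matrix.vecMul v (globalTwist ℓ W)⁻¹) Y =
      Matrix.vecMul (Matrix.vecMul v X) (globalTwist ℓ W)⁻¹ := by
  obtain ⟨h1, h2⟩ := globalTwist_mul_inv ℓ hW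
  rw [Matrix.vecMul_vecMul, Matrix.vecMul_vecMul]
  congr 1
  calc (globalTwist ℓ W)⁻¹ * Y = (globalTwist ℓ W)⁻¹ * (Y * globalTwist ℓ W) *
        (globalTwist ℓ W)⁻¹ := by rw [mul_assoc, mul_assoc, h1, mul_one]
    _ = X * (globalTwist ℓ W)⁻¹ := by rw [← h, ← mul_assoc, h2, one_mul]

theorem isCovectorBasis_vecMul_inv_twist (hW : IsUnit W.det) {v : Conf ℓ → Covec ℓ}
    (hv : IsCovectorBasis v) :
    IsCovectorBasis fun h => Matrix.vecMul (v h) (globalTwist ℓ W)⁻¹ := by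
  obtain ⟨h1, h2⟩ := globalTwist_mul_inv ℓ hW
  refine isCovectorBasis_of_linearIndependent
    (hv.1.map' ((globalTwist ℓ W)⁻¹).vecMulLinear (LinearMap.ker_eq_bot.mpr fun x y hxy => ?_))
  have h := congrArg (Matrix.vecMul · (globalTwist ℓ W)) hxy
  simpa [Matrix.vecMul_vecMul, h2] using h

theorem sovCovec_vecMul_inv_twist (hW : IsUnit W.det) (S : Covec ℓ) (h : Conf ℓ) :
    sovCovec ℓ η ξ K k₂ (Matrix.vecMul S (globalTwist ℓ W)⁻¹) h =
      Matrix.vecMul (sovCovec ℓ η ξ (conjTwist W K) k₂ S h) (globalTwist ℓ W)⁻¹ := by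
  refine vecMul_inv_twist hW (ofFn_prod_semiconj _ _ _ fun n => ?_) S
  rw [mul_smul_comm, smul_mul_assoc, twist_mul_fusedTransfer ℓ η ξ W K hW]

theorem det_conjTwist (hW : IsUnit W.det) : (conjTwist W K).det = K.det := by
  rw [conjTwist, Matrix.det_conj' ((Matrix.isUnit_iff_isUnit_det W).mpr hW)]

/-- A lower triangular non-scalar matrix is conjugate to one with nonzero off-diagonal entries. -/
theorem exists_conjTwist_ne_zero (hb : K 0 1 = 0)
    (hK : ∀ α : ℂ, K ≠ α • (1 : Matrix (Fin 2) (Fin 2) ℂ)) :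
    ∃ W : Matrix (Fin 2) (Fin 2) ℂ,
      IsUnit W.det ∧ conjTwist W K 0 1 ≠ 0 ∧ conjTwist W K 1 0 ≠ 0 := by
  -- The two expressions are the off-diagonal entries of W⁻¹KW for the determinant-one matrix W with
  -- rows (1, s) and (t, 1 + st). It remains to choose s and t, according to whether c or a - d
  -- vanishes.
  have key : ∀ s t : ℂ, s * ((K 0 0 - K 1 1) * (1 + s * t) - K 1 0 * s) ≠ 0 →
      K 1 0 + (K 1 1 - K 0 0) * t ≠ 0 → ∃ W : Matrix (Fin 2) (Fin 2) ℂ,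
        IsUnit W.det ∧ conjTwist W K 0 1 ≠ 0 ∧ conjTwist W K 1 0 ≠ 0 := by
    intro s t h1 h2
    have hdet : (!![1, s; t, 1 + s * t] : Matrix (Fin 2) (Fin 2) ℂ).det = 1 := by
      rw [Matrix.det_fin_two_of]; ring
    have hinv : (!![1, s; t, 1 + s * t] : Matrix (Fin 2) (Fin 2) ℂ)⁻¹ =
        !![1 + s * t, -s; -t, 1] := by
      rw [Matrix.inv_def, hdet, Matrix.adjugate_fin_two_of]
      simp
    refine ⟨!![1, s; t, 1 + s * t], by rw [hdet]; exact isUnit_one, ?_, ?_⟩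
    · convert h1 using 1
      rw [conjTwist, hinv]
      simp [Matrix.mul_apply, Matrix.vecMul, dotProduct, Fin.sum_univ_two, hb]
      ring
    · convert h2 using 1
      rw [conjTwist, hinv]
      simp [Matrix.mul_apply, Matrix.vecMul, dotProduct, Fin.sum_univ_two, hb]
      ring
  by_cases hc : K 1 0 = 0
  · have had : K 0 0 - K 1 1 ≠ 0 := by
      intro had
      refine hK (K 0 0) ?_
      ext i j
      fin_cases i <;> fin_cases j <;> simp [hb, hc, sub_eq_zero.mp had]
    refine key 1 1 ?_ ?_
    · simp only [hc]
      ring_nf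
      intro h
      exact had (by linear_combination h / 2)
    · rw [hc]
      intro h
      exact had (by linear_combination -h)
  · by_cases had : K 0 0 - K 1 1 = 0
    · refine key 1 0 ?_ ?_
      · simpa [had] using hc
      · simpa using hc
    · refine key ((K 0 0 - K 1 1) / (2 * K 1 0)) 0 ?_ (by simpa using hc)
      refine mul_ne_zero (div_ne_zero had (mul_ne_zero two_ne_zero hc)) ?_
      have : (K 0 0 - K 1 1) * (1 + (K 0 0 - K 1 1) / (2 * K 1 0) * 0) -
          K 1 0 * ((K 0 0 - K 1 1) / (2 * K 1 0)) = (K 0 0 - K 1 1) / 2 := by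
        field_simp
        ring
      rw [this]
      exact div_ne_zero had two_ne_zero

end Twisted

end SoV

theorem theorem4p4 (N : ℕ) (ℓ : Fin N → ℕ) (hℓ : ∀ n, 0 < ℓ n) (η : ℂ) (hη : η ≠ 0)
    (K : Matrix (Fin 2) (Fin 2) ℂ) (hK : IsUnit K.det)
    (hK' : ∀ α : ℂ, K ≠ α • (1 : Matrix (Fin 2) (Fin 2) ℂ))
    (k₁ k₂ : ℂ)
    (hk : K.charpoly = (Polynomial.X - Polynomial.C k₁) * (Polynomial.X - Polynomial.C k₂))
    (ξ : Fin N → ℂ) (hξ : StringsDisjoint ℓ η ξ) :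
    -- basis for all covectors `S` outside the zero set of a nonzero polynomial
    (∃ P : MvPolynomial (Conf ℓ) ℂ, P ≠ 0 ∧
      ∀ S : Covec ℓ, MvPolynomial.eval S P ≠ 0 → IsCovectorBasis (sovCovec ℓ η ξ K k₂ S)) ∧
    -- the case `b ≠ 0`
    (K 0 1 ≠ 0 →
      IsCovectorBasis (skCovec ℓ η ξ K k₁) ∧
      (∀ (h : Conf ℓ) (u : ℂ),
        Matrix.vecMul (skCovec ℓ η ξ K k₁ h) (opB ℓ η ξ K u) =
          (K 0 1 * ∏ n, (u - node ℓ η ξ n (h n))) • skCovec ℓ η ξ K k₁ h) ∧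
      ∀ h : Conf ℓ,
        sovCovec ℓ η ξ K k₂ (skCovec ℓ η ξ K k₁ (topConf ℓ)) h = skCovec ℓ η ξ K k₁ h) ∧
    -- the case `b = 0`
    (K 0 1 = 0 →
      (∃ W : Matrix (Fin 2) (Fin 2) ℂ,
        IsUnit W.det ∧ conjTwist W K 0 1 ≠ 0 ∧ conjTwist W K 1 0 ≠ 0) ∧
      ∀ W : Matrix (Fin 2) (Fin 2) ℂ, IsUnit W.det → conjTwist W K 0 1 ≠ 0 →
        IsCovectorBasis (skCovecTilde ℓ η ξ K W k₁) ∧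
        (∀ (h : Conf ℓ) (u : ℂ),
          Matrix.vecMul (skCovecTilde ℓ η ξ K W k₁ h) (opBTilde ℓ η ξ K W u) =
            (conjTwist W K 0 1 * ∏ n, (u - node ℓ η ξ n (h n))) •
              skCovecTilde ℓ η ξ K W k₁ h) ∧
        ∀ h : Conf ℓ,
          sovCovec ℓ η ξ K k₂ (skCovecTilde ℓ η ξ K W k₁ (topConf ℓ)) h =
            skCovecTilde ℓ η ξ K W k₁ h) := by
  -- The eigenvalues enter only through k₁k₂ = det K, so their order is irrelevant and conjugating K
  -- changes nothing.
  have hdet := SoV.det_eq_of_charpoly hk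
  rw [hdet] at hK
  have hk₁ : k₁ ≠ 0 := left_ne_zero_of_mul hK.ne_zero
  have hk₂ : k₂ ≠ 0 := right_ne_zero_of_mul hK.ne_zero
  have generic : K 0 1 ≠ 0 →
      IsCovectorBasis (skCovec ℓ η ξ K k₁) ∧
      (∀ (h : Conf ℓ) (u : ℂ),
        Matrix.vecMul (skCovec ℓ η ξ K k₁ h) (opB ℓ η ξ K u) =
          (K 0 1 * ∏ n, (u - node ℓ η ξ n (h n))) • skCovec ℓ η ξ K k₁ h) ∧
      ∀ h : Conf ℓ,
        sovCovec ℓ η ξ K k₂ (skCovec ℓ η ξ K k₁ (topConf ℓ)) h = skCovec ℓ η ξ K k₁ h :=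
    fun hb => ⟨SoV.isCovectorBasis_skCovec hη hξ hk₁ hk₂ hdet hb,
      fun h u => SoV.skLabel_opB ℓ ξ K k₁ hη (fun n => h n) u,
      SoV.sovCovec_skCovec hη hξ hk₁ hk₂ hdet hb⟩
  have twisted : ∀ W : Matrix (Fin 2) (Fin 2) ℂ, IsUnit W.det → conjTwist W K 0 1 ≠ 0 →
      IsCovectorBasis (skCovecTilde ℓ η ξ K W k₁) ∧
      (∀ (h : Conf ℓ) (u : ℂ),
        Matrix.vecMul (skCovecTilde ℓ η ξ K W k₁ h) (opBTilde ℓ η ξ K W u) =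
          (conjTwist W K 0 1 * ∏ n, (u - node ℓ η ξ n (h n))) •
            skCovecTilde ℓ η ξ K W k₁ h) ∧
      ∀ h : Conf ℓ,
        sovCovec ℓ η ξ K k₂ (skCovecTilde ℓ η ξ K W k₁ (topConf ℓ)) h =
          skCovecTilde ℓ η ξ K W k₁ h := by
    intro W hW hb
    have hdet' : (conjTwist W K).det = k₁ * k₂ := (SoV.det_conjTwist hW).trans hdet
    refine ⟨SoV.isCovectorBasis_vecMul_inv_twist hW
      (SoV.isCovectorBasis_skCovec hη hξ hk₁ hk₂ hdet' hb), fun h u => ?_, fun h => ?_⟩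
    · have hB := SoV.skLabel_opB ℓ ξ (conjTwist W K) k₁ hη (fun n => h n) u
      rw [← SoV.skCovec_eq_skLabel] at hB
      rw [skCovecTilde, SoV.vecMul_inv_twist hW (SoV.twist_mul_opB ℓ η ξ W K u), hB,
        Matrix.smul_vecMul]
    · rw [skCovecTilde, SoV.sovCovec_vecMul_inv_twist hW,
        SoV.sovCovec_skCovec hη hξ hk₁ hk₂ hdet' hb, skCovecTilde]
  refine ⟨?_, generic, fun hb => ⟨SoV.exists_conjTwist_ne_zero hb hK', twisted⟩⟩
  by_cases hb : K 0 1 = 0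
  · obtain ⟨W, hW, hb', -⟩ := SoV.exists_conjTwist_ne_zero hb hK'
    obtain ⟨h1, -, h2⟩ := twisted W hW hb'
    refine SoV.exists_mvPolynomial_of_isCovectorBasis
      (S₀ := skCovecTilde ℓ η ξ K W k₁ (topConf ℓ)) ?_
    rwa [funext h2]
  · obtain ⟨h1, -, h2⟩ := generic hb
    refine SoV.exists_mvPolynomial_of_isCovectorBasis
      (S₀ := skCovec ℓ η ξ K k₁ (topConf ℓ)) ?_
    rwa [funext h2]
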